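/- Let $\mathscr{P}$ be the set of all integer partitions, and for $f:\mathscr{P}\to\mathbb{Q}$ let $$\langle f\rangle_q=\frac{\sum_{\lambda\in\mathscr{P}}f(\lambda)\,q^{|\lambda|}}{\sum_{\lambda\in\mathscr{P}}q^{|\lambda|}}\in\mathbb{Q}[[q]]$$ be its $q$-bracket. For positive even $k$ let $S_k(\lambda)=-\frac{B_k}{2k}+\sum_i\lambda_i^{k-1}$, where $B_k$ is the $k$th Bernoulli number and the sum runs over the parts of $\lambda$, let $$G_k=-\frac{B_k}{2k}+\sum_{m,r\ge1}m^{k-1}q^{mr}\in\mathbb{Q}[[q]]$$ be the Eisenstein series, and let $D=q\frac{d}{dq}$. Let $\mathcal{S}$ be the $\mathbb{Q}$-algebra of functions on $\mathscr{P}$ generated by the $S_k$ ($k\geq 2$ even) under the pointwise product; its subspace $\mathcal{S}_w$ of weight $w$ is the span of all products $S_{k_1}\cdots S_{k_n}$ ($n\ge0$, all $k_i$ positive and even) with $k_1+\cdots+k_n=w$. Let $\Pi(n)$ be the set of partitions of the set $\{1,\dots,n\}$, ordered by refinement, with Möbius function $\mu$ and largest element $\mathbf{1}_n$. For $n\ge1$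 and $f_1,\dots,f_n:\mathscr{P}\to\mathbb{Q}$ the connected $q$-bracket is $$\langle f_1\otimes\cdots\otimes f_n\rangle_q=\sum_{\alpha\in\Pi(n)}\mu(\alpha,\mathbf{1}_n)\prod_{A\in\alpha}\Bigl\langle\prod_{a\in A}f_a\Bigr\rangle_q .$$ **Theorem.** (a) $\mathcal{S}$ is a quasimodular algebra: $\mathcal{S}=\bigoplus_{w\ge0}\mathcal{S}_w$ is a graded algebra, and for every $w$ and every $f\in\mathcal{S}_w$ the power series $\langle f\rangle_q$ is the $q$-expansion ($q=e^{2\pi i\tau}$) of a quasimodular form of weight $w$ for $\mathrm{SL}_2(\mathbb{Z})$. Here a quasimodular form of weight $w$ is a function $\phi$ on the upper half plane $\mathfrak{H}$ for which there are $p\ge0$ and functions $\phi_0,\dots,\phi_p$ on $\mathfrak{H}$ such that $$(c\tau+d)^{-w}\phi\Bigl(\frac{a\tau+b}{c\tau+d}\Bigr)=\sum_{r=0}^p\phi_r(\tau)\Bigl(\frac{c}{c\tau+d}\Bigr)^r$$ for all $\tau\in\mathfrak{H}$ and $\left(\begin{smallmatrix}a&b\\c&d\end{smallmatrix}\right)\in\mathrm{SL}_2(\mathbb{Z})$,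 where $\phi,\phi_0,\dots,\phi_p$ are holomorphic and of moderate growth, i.e. for all $C>0$ they are $O(e^{Cy})$ as $y=\operatorname{Im}\tau\to\infty$ and $O(e^{C/y})$ as $y\to0$, uniformly in $\operatorname{Re}\tau$. (b) For all $n\ge0$ and all positive even integers $k_1,\dots,k_n$, $$\langle S_{k_1}\cdots S_{k_n}\rangle_q=\sum_{\alpha\in\Pi(n)}\prod_{A\in\alpha}D^{|A|-1}G_{|k_A|-2|A|+2},\qquad |k_A|=\sum_{a\in A}k_a .$$ (c) For all $n\ge1$ and all positive even integers $k_1,\dots,k_n$, $$\langle S_{k_1}\otimes\cdots\otimes S_{k_n}\rangle_q=D^{n-1}G_{k_1+\cdots+k_n-2n+2}.$$ -/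

import Mathlib

open scoped MatrixGroups Manifold BigOperators Topology

noncomputable section

namespace PartitionBracket

/-! ### Integer partitions, the `q`-bracket and the moment functions -/

/-- The set of all integer partitions (of all natural numbers, including the empty partition). -/
abbrev IntPartition : Type := Σ n : ℕ, Nat.Partition n

/-- The `q`-bracket `(∑_λ f(λ) q^|λ|) / (∑_λ q^|λ|)` of a function on partitions.
The denominator has constant coefficient `1`, so the inverse is a genuine inverse. -/
def qBracket (f : IntPartition → ℚ) : PowerSeries ℚ :=
  PowerSeries.mk (fun n => ∑ l : Nat.Partition n, f ⟨n, l⟩) *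
    (PowerSeries.mk (fun n => ((Fintype.card (Nat.Partition n) : ℕ) : ℚ)))⁻¹

/-- The moment function `S_k(λ) = -B_k/(2k) + ∑_i λ_i^(k-1)` (used for positive even `k`). -/
def momentFn (k : ℕ) : IntPartition → ℚ := fun l =>
  -(bernoulli k) / (2 * (k : ℚ)) + (l.2.parts.map (fun m => (m : ℚ) ^ (k - 1))).sum

/-- The algebra `𝒮` generated by the moment functions `S_k`, `k` positive and even, under the
pointwise product. -/
def momentAlgebra : Subalgebra ℚ (IntPartition → ℚ) :=
  Algebra.adjoin ℚ {f | ∃ k : ℕ, 0 < k ∧ Even k ∧ f = momentFn k}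

/-- The weight-`w` part of `𝒮`: the span of the products `S_{k_1} ⋯ S_{k_n}` with all `k_i`
positive and even and `k_1 + ⋯ + k_n = w`, so that `S_k` has weight `k`. -/
def momentGrading (w : ℕ) : Submodule ℚ momentAlgebra :=
  (Submodule.span ℚ {f : IntPartition → ℚ | ∃ (n : ℕ) (k : Fin n → ℕ),
    (∀ i, 0 < k i ∧ Even (k i)) ∧ ∑ i, k i = w ∧ f = ∏ i, momentFn (k i)}).comap
      momentAlgebra.val.toLinearMap

/-! ### Quasimodular forms -/

/-- Holomorphic functions of moderate growth on the upper half plane: for all `C > 0`,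
`φ(x+iy) = O(e^(Cy))` as `y → ∞` and `φ(x+iy) = O(e^(C/y))` as `y → 0`, uniformly in `x`. -/
structure IsHolModerate (φ : UpperHalfPlane → ℂ) : Prop where
  holomorphic : MDifferentiable 𝓘(ℂ) 𝓘(ℂ) φ
  growth_infinity : ∀ C : ℝ, 0 < C →
    Asymptotics.IsBigO UpperHalfPlane.atImInfty φ (fun τ => Real.exp (C * τ.im))
  growth_zero : ∀ C : ℝ, 0 < C →
    Asymptotics.IsBigO (Filter.comap UpperHalfPlane.im (𝓝 (0 : ℝ))) φ
      (fun τ => Real.exp (C / τ.im))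

/-- Quasimodular forms of weight `k` and depth at most `p` for `SL₂(ℤ)`. -/
def IsQuasimodularForm (k : ℤ) (p : ℕ) (φ : UpperHalfPlane → ℂ) : Prop :=
  IsHolModerate φ ∧ ∃ ψ : Fin (p + 1) → UpperHalfPlane → ℂ, (∀ r, IsHolModerate (ψ r)) ∧
    ∀ (γ : SL(2, ℤ)) (τ : UpperHalfPlane),
      ((γ 1 0 : ℂ) * (τ : ℂ) + (γ 1 1 : ℂ)) ^ (-k) * φ (γ • τ) =
        ∑ r : Fin (p + 1),
          ψ r τ * ((γ 1 0 : ℂ) / ((γ 1 0 : ℂ) * (τ : ℂ) + (γ 1 1 : ℂ))) ^ (r : ℕ)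

/-- A power series in `q` is (the `q`-expansion, `q = e^(2πiτ)`, of) a quasimodular form of
weight `k`, of some depth. -/
def IsQuasimodularSeries (k : ℤ) (F : PowerSeries ℚ) : Prop :=
  ∃ (p : ℕ) (φ : UpperHalfPlane → ℂ), IsQuasimodularForm k p φ ∧
    ∀ τ : UpperHalfPlane,
      HasSum (fun n : ℕ => ((PowerSeries.coeff n F : ℚ) : ℂ) *
        Complex.exp (2 * (Real.pi : ℂ) * Complex.I * (τ : ℂ)) ^ n) (φ τ)

/-- A subalgebra `A` of the algebra of functions on partitions (with the pointwise product),
together with weight spaces `𝒜 k`, is a quasimodular algebra if the `𝒜 k` make it a graded algebra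
and the `q`-bracket of every element of weight `k` is a quasimodular form of weight `k`. -/
structure IsQuasimodularAlgebra (A : Subalgebra ℚ (IntPartition → ℚ))
    (𝒜 : ℕ → Submodule ℚ A) : Prop where
  gradedMonoid : SetLike.GradedMonoid 𝒜
  isInternal : DirectSum.IsInternal 𝒜
  quasimodular : ∀ (k : ℕ) (f : A), f ∈ 𝒜 k →
    IsQuasimodularSeries (k : ℤ) (qBracket (f : IntPartition → ℚ))

/-! ### Eisenstein series and the derivative -/

/-- The Eisenstein series `G_k = -B_k/(2k) + ∑_{m,r ≥ 1} m^(k-1) q^(mr)` (used for positive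
even `k`), as a power series in `q`. -/
def eisensteinG (k : ℕ) : PowerSeries ℚ :=
  PowerSeries.mk fun n =>
    if n = 0 then -(bernoulli k) / (2 * (k : ℚ)) else ∑ m ∈ n.divisors, (m : ℚ) ^ (k - 1)

/-- The derivation `D = q d/dq`. -/
def qDeriv (F : PowerSeries ℚ) : PowerSeries ℚ :=
  PowerSeries.X * PowerSeries.derivative ℚ F

/-! ### Set partitions and the connected `q`-bracket -/

/-- The set `Π(n)` of partitions of an `n`-element set; Mathlib's order is refinement, and its
top element is the one-block partition. -/
abbrev SetPartition (n : ℕ) : Type := Finpartition (Finset.univ : Finset (Fin n))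

open scoped Classical in
instance instLocallyFiniteOrderSetPartition (n : ℕ) : LocallyFiniteOrder (SetPartition n) :=
  Fintype.toLocallyFiniteOrder

open scoped Classical in
/-- The connected `q`-bracket
`⟨f_1 ⊗ ⋯ ⊗ f_n⟩_q = ∑_{α ∈ Π(n)} μ(α, 1_n) ∏_{A ∈ α} ⟨∏_{a ∈ A} f_a⟩_q`, with `μ` the Möbius
function of the partition lattice `Π(n)`. -/
def connectedBracket {n : ℕ} (f : Fin n → IntPartition → ℚ) : PowerSeries ℚ :=
  ∑ α : SetPartition n,
    (IncidenceAlgebra.mu ℚ (α := SetPartition n) α ⊤) •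
      ∏ A ∈ α.parts, qBracket (∏ a ∈ A, f a)

end PartitionBracket

end

/-! Everything rests on one identity for the numerators `partitionSeries`. Write S_{k_a} as a
constant plus a power sum over parts, and count each part m once for every r with 1 ≤ r ≤
(multiplicity of m). Removing r copies of m is a bijection onto the partitions of N - mr, and
putting them back shifts each S_k by r·m^(k-1). Expanding the product of shifted factors over the
subset A of factors that contribute a shift gives ⟨∏_{a ∪ B} S⟩ = ∑_{A ⊆ B} K(a ∪ A) ⟨∏_{B \ A} S⟩.
With n = mr, the coefficient ∑_{m ∣ n} m^(k_a-1) ∏_{i ∈ A} r·m^(k_i-1) of K is n^|A| times a divisor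
sum, so K is a derivative of an Eisenstein series (`blockCumulant_insert`,
`partitionSeries_mul_prod`).

Sums over set partitions satisfy the same recursion: choose the block a ∪ A of a, then partition the
rest (`sumProd_insert`). This gives (b). For (c), a product of such sums over the blocks of α is a
sum over refinements of α (`prod_sumProd`), and Möbius inversion keeps only the one-block partition.

For (a), the S_k are algebraically independent: on partitions with parts 1, …, n and arbitrary
multiplicities they are affine functions of the multiplicities with an invertible Vandermonde-type
matrix. So 𝒮 is a polynomial ring and its grading is the weighted one. Quasimodularity follows from
(b), since series with quasimodular transformation behaviour are closed under sums, products and D,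
and the G_k are among them; D^(|A|-1) G_{|k_A|-2|A|+2} has weight |k_A|, and these weights add up
over the blocks. -/

noncomputable section

namespace PartitionBracket

/-! ### Adding equal parts to a partition -/

/-- Adjoin `r` parts equal to `m` to a partition. -/
def addParts (m r : ℕ) (hm : 0 < m) (l : IntPartition) : IntPartition :=
  ⟨l.1 + m * r, ⟨l.2.parts + Multiset.replicate r m, fun {i} hi => by
    rcases Multiset.mem_add.1 hi with h | h
    · exact l.2.parts_pos h
    · exact (Multiset.eq_of_mem_replicate h).symm ▸ hm, by
    simp [l.2.parts_sum, mul_comm]⟩⟩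

theorem IntPartition.ext_parts {l l' : IntPartition} (h : l.2.parts = l'.2.parts) : l = l' := by
  obtain ⟨n, l⟩ := l
  obtain ⟨n', l'⟩ := l'
  obtain rfl : n = n' := by rw [← l.parts_sum, ← l'.parts_sum]; exact congrArg _ h
  congr 1
  exact Nat.Partition.ext h

theorem momentFn_apply (k : ℕ) (l : IntPartition) : momentFn k l =
    -(bernoulli k) / (2 * (k : ℚ)) + (l.2.parts.map fun m : ℕ => (m : ℚ) ^ (k - 1)).sum := by
  simp [momentFn]

theorem momentFn_addParts (k m r : ℕ) (hm : 0 < m) (l : IntPartition) :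
    momentFn k (addParts m r hm l) = momentFn k l + (r : ℚ) * (m : ℚ) ^ (k - 1) := by
  simp [momentFn_apply, addParts, add_assoc]

/-- Removing r copies of m is a bijection from the partitions of N with at least r parts m onto the
partitions of N - mr; its inverse is `addParts`. -/
theorem sum_partition_count_ge (f : IntPartition → ℚ) (N m r : ℕ) (hm : 0 < m) :
    ∑ l : Nat.Partition N, (if r ≤ l.parts.count m then f ⟨N, l⟩ else 0) =
      if m * r ≤ N then ∑ l : Nat.Partition (N - m * r), f (addParts m r hm ⟨_, l⟩) else 0 := by
  rw [← Finset.sum_filter]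
  split_ifs with h
  · refine Finset.sum_bij' (fun l hl => ⟨l.parts - Multiset.replicate r m, fun {i} hi =>
      l.parts_pos (Multiset.mem_of_le (Multiset.sub_le_self _ _) hi), ?_⟩)
      (fun l _ => ⟨l.parts + Multiset.replicate r m,
        (addParts m r hm ⟨_, l⟩).2.parts_pos, ?_⟩) ?_ ?_ ?_ ?_ ?_
    · rw [Finset.mem_filter] at hl
      have h1 := Multiset.sub_add_cancel (Multiset.le_count_iff_replicate_le.1 hl.2)
      have h2 := congrArg Multiset.sum h1
      rw [Multiset.sum_add, l.parts_sum, Multiset.sum_replicate, smul_eq_mul, mul_comm] at h2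
      omega
    · simp [l.parts_sum, mul_comm r m, h]
    · simp
    · intro l _
      simp
    · intro l hl
      rw [Finset.mem_filter] at hl
      exact Nat.Partition.ext (Multiset.sub_add_cancel (Multiset.le_count_iff_replicate_le.1 hl.2))
    · intro l _
      exact Nat.Partition.ext Multiset.add_sub_cancel_right
    · intro l hl
      rw [Finset.mem_filter] at hl
      congr 1
      exact IntPartition.ext_parts
        (Multiset.sub_add_cancel (Multiset.le_count_iff_replicate_le.1 hl.2)).symm
  · refine Finset.sum_eq_zero fun l hl => absurd ?_ h
    rw [Finset.mem_filter] at hl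
    obtain ⟨s, hs⟩ := Multiset.le_iff_exists_add.1 (Multiset.le_count_iff_replicate_le.1 hl.2)
    have h2 := congrArg Multiset.sum hs
    rw [Multiset.sum_add, l.parts_sum, Multiset.sum_replicate, smul_eq_mul, mul_comm] at h2
    omega

/-- The multiplicity of m equals the number of r ≥ 1 not exceeding it. Parts and multiplicities are
at most N, so a box independent of the partition suffices and the sums can later be interchanged. -/
theorem sum_map_parts_eq (g : ℕ → ℚ) {N : ℕ} (l : Nat.Partition N) :
    (l.parts.map g).sum =
      ∑ x ∈ Finset.Icc 1 N ×ˢ Finset.Icc 1 N, if x.2 ≤ l.parts.count x.1 then g x.1 else 0 := by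
  have hle : ∀ m, 0 < m → l.parts.count m ≤ N := by
    intro m hm
    obtain ⟨s, hs⟩ := Multiset.le_iff_exists_add.1
      (Multiset.le_count_iff_replicate_le.1 (le_refl (l.parts.count m)))
    have h2 := congrArg Multiset.sum hs
    rw [Multiset.sum_add, l.parts_sum, Multiset.sum_replicate, smul_eq_mul] at h2
    have := Nat.le_mul_of_pos_right (l.parts.count m) hm
    omega
  rw [Finset.sum_product, Finset.sum_multiset_map_count]
  rw [Finset.sum_subset (s₂ := Finset.Icc 1 N)]
  · refine Finset.sum_congr rfl fun m hm => ?_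
    rw [Finset.mem_Icc] at hm
    rw [← Finset.sum_filter]
    dsimp only
    rw [Finset.sum_const]
    congr 1
    have : (Finset.Icc 1 N).filter (fun r => r ≤ l.parts.count m) =
        Finset.Icc 1 (l.parts.count m) := by
      ext r
      have := hle m hm.1
      simp only [Finset.mem_filter, Finset.mem_Icc]
      omega
    simp [this]
  · intro m hm
    rw [Multiset.mem_toFinset] at hm
    exact Finset.mem_Icc.2 ⟨l.parts_pos hm, l.le_of_mem_parts hm⟩
  · intro m _ hm
    rw [Multiset.mem_toFinset] at hm
    simp [Multiset.count_eq_zero_of_notMem hm]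

theorem sum_range_divisors (N : ℕ) (H : ℕ → ℕ → ℚ) :
    ∑ d ∈ Finset.range (N + 1), ∑ m ∈ d.divisors, H m (d / m) =
      ∑ x ∈ Finset.Icc 1 N ×ˢ Finset.Icc 1 N, if x.1 * x.2 ≤ N then H x.1 x.2 else 0 := by
  rw [← Finset.sum_filter]
  rw [← Finset.sum_fiberwise_of_maps_to (t := Finset.range (N + 1)) (g := fun x : ℕ × ℕ => x.1 * x.2)
    (by intro x hx; rw [Finset.mem_filter] at hx; exact Finset.mem_range.2 (by omega))]
  refine Finset.sum_congr rfl fun d hd => ?_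
  rw [← Nat.sum_divisorsAntidiagonal (fun a b => H a b)]
  refine Finset.sum_congr ?_ fun _ _ => rfl
  ext ⟨a, b⟩
  simp only [Nat.mem_divisorsAntidiagonal, Finset.mem_filter, Finset.mem_product, Finset.mem_Icc]
  rw [Finset.mem_range] at hd
  constructor
  · rintro ⟨rfl, h⟩
    have ha : 0 < a := Nat.pos_of_ne_zero (by rintro rfl; simp at h)
    have hb : 0 < b := Nat.pos_of_ne_zero (by rintro rfl; simp at h)
    have h1 : a ≤ a * b := Nat.le_mul_of_pos_right _ hb
    have h2 : b ≤ a * b := Nat.le_mul_of_pos_left _ ha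
    omega
  · rintro ⟨⟨⟨⟨h1, h2⟩, h3, h4⟩, h5⟩, rfl⟩
    exact ⟨rfl, by positivity⟩

/-- Combines the layer count of multiplicities with removal of parts, then groups the pairs (m, r)
by d = mr, which puts the result in the shape of a Cauchy product. -/
theorem sum_power_sum_mul (g : ℕ → ℚ) (f : IntPartition → ℚ) (N : ℕ) :
    ∑ l : Nat.Partition N, (l.parts.map g).sum * f ⟨N, l⟩ =
      ∑ p ∈ Finset.HasAntidiagonal.antidiagonal N, ∑ m ∈ p.1.divisors.attach, g m *
        ∑ l : Nat.Partition p.2,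
          f (addParts m (p.1 / m) (Nat.pos_of_mem_divisors m.2) ⟨p.2, l⟩) := by
  -- `addParts` needs a proof that m is positive; the value 0 at m = 0 never enters the sums.
  let H : ℕ → ℕ → ℚ := fun m r =>
    if hm : 0 < m then g m * ∑ l : Nat.Partition (N - m * r), f (addParts m r hm ⟨_, l⟩) else 0
  have hR : ∀ p ∈ Finset.HasAntidiagonal.antidiagonal N, (∑ m ∈ p.1.divisors.attach, g m *
        ∑ l : Nat.Partition p.2,
          f (addParts m (p.1 / m) (Nat.pos_of_mem_divisors m.2) ⟨p.2, l⟩)) =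
      ∑ m ∈ p.1.divisors, H m (p.1 / m) := by
    rintro ⟨d, e⟩ hp
    rw [← Finset.sum_attach d.divisors]
    refine Finset.sum_congr rfl fun m _ => ?_
    have hm := Nat.pos_of_mem_divisors m.2
    simp only [H, dif_pos hm]
    rw [Nat.mul_div_cancel' (Nat.dvd_of_mem_divisors m.2)]
    rw [Finset.HasAntidiagonal.mem_antidiagonal] at hp
    obtain rfl : e = N - d := by simp only at hp; omega
    rfl
  rw [Finset.sum_congr rfl hR, Finset.Nat.sum_antidiagonal_eq_sum_range_succ_mk,
    sum_range_divisors N H]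
  simp_rw [sum_map_parts_eq, Finset.sum_mul]
  rw [Finset.sum_comm]
  refine Finset.sum_congr rfl fun x hx => ?_
  rw [Finset.mem_product, Finset.mem_Icc, Finset.mem_Icc] at hx
  have hm : 0 < x.1 := hx.1.1
  have := sum_partition_count_ge f N x.1 x.2 hm
  simp only [H, dif_pos hm]
  rw [← mul_ite_zero, ← this, Finset.mul_sum]
  refine Finset.sum_congr rfl fun l _ => ?_
  split_ifs <;> simp

/-! ### The recursion for the `q`-brackets of products of moment functions -/

theorem coeff_qDeriv_iterate (j n : ℕ) (F : PowerSeries ℚ) :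
    PowerSeries.coeff n (qDeriv^[j] F) = (n : ℚ) ^ j * PowerSeries.coeff n F := by
  induction j with
  | zero => simp
  | succ j ih =>
    rw [Function.iterate_succ_apply', qDeriv]
    cases n with
    | zero => simp
    | succ n =>
      rw [PowerSeries.coeff_succ_X_mul, PowerSeries.coeff_derivative, ih]
      push_cast
      ring

/-- The numerator `∑_λ f(λ) q^|λ|` of the `q`-bracket. -/
def partitionSeries (f : IntPartition → ℚ) : PowerSeries ℚ :=
  PowerSeries.mk fun n => ∑ l : Nat.Partition n, f ⟨n, l⟩

/-- The cumulant `D^(|A|-1) G_(|k_A|-2|A|+2)` attached to a block `A`. -/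
def blockCumulant {ι : Type*} (k : ι → ℕ) (A : Finset ι) : PowerSeries ℚ :=
  qDeriv^[A.card - 1] (eisensteinG ((∑ i ∈ A, k i) + 2 - 2 * A.card))

/-- For n = mr the factor n^|A| produced by D^|A| splits as m^|A| r^|A|, giving each i ∈ A one r and
raising m^(k_i-2) to m^(k_i-1). Any derivative kills the constant term, so it survives only for A =
∅. -/
theorem blockCumulant_insert {ι : Type*} [DecidableEq ι] (k : ι → ℕ) (hk : ∀ i, 2 ≤ k i)
    {a : ι} {A : Finset ι} (ha : a ∉ A) :
    blockCumulant k (insert a A) =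
      PowerSeries.C (if A = ∅ then -(bernoulli (k a)) / (2 * (k a : ℚ)) else 0) +
        PowerSeries.mk fun n => ∑ m ∈ n.divisors, (m : ℚ) ^ (k a - 1) *
          ∏ i ∈ A, (((n / m : ℕ) : ℚ) * (m : ℚ) ^ (k i - 1)) := by
  ext n
  rw [blockCumulant, Finset.card_insert_of_notMem ha, Finset.sum_insert ha, coeff_qDeriv_iterate,
    Nat.add_sub_cancel, map_add, eisensteinG, PowerSeries.coeff_mk, PowerSeries.coeff_mk,
    PowerSeries.coeff_C]
  have hsum : ∑ i ∈ A, k i = ∑ i ∈ A, (k i - 2) + 2 * A.card := by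
    rw [Finset.card_eq_sum_ones, Finset.mul_sum, ← Finset.sum_add_distrib]
    exact Finset.sum_congr rfl fun i _ => by have := hk i; omega
  rcases eq_or_ne n 0 with rfl | hn
  · rcases eq_or_ne A ∅ with rfl | hA
    · simp
    · simp [hA]
  · rw [if_neg hn, if_neg hn, zero_add, Finset.mul_sum]
    refine Finset.sum_congr rfl fun m hm => ?_
    have hmn : (n : ℚ) ^ A.card = (m : ℚ) ^ A.card * ((n / m : ℕ) : ℚ) ^ A.card := by
      rw [← mul_pow, ← Nat.cast_mul, Nat.mul_div_cancel' (Nat.dvd_of_mem_divisors hm)]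
    have hprod : ∏ i ∈ A, (((n / m : ℕ) : ℚ) * (m : ℚ) ^ (k i - 1)) =
        ((n / m : ℕ) : ℚ) ^ A.card * ((m : ℚ) ^ A.card * (m : ℚ) ^ (∑ i ∈ A, (k i - 2))) := by
      rw [Finset.prod_mul_distrib, Finset.prod_const, ← Finset.prod_pow_eq_pow_sum,
        ← Finset.prod_const (m : ℚ), ← Finset.prod_mul_distrib]
      congr 1
      refine Finset.prod_congr rfl fun i _ => ?_
      rw [← pow_succ']
      have := hk i
      congr 1
      omega
    have hexp : k a + ∑ i ∈ A, k i + 2 - 2 * (A.card + 1) - 1 =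
        (k a - 1) + ∑ i ∈ A, (k i - 2) := by
      have := hk a
      omega
    rw [hprod, hexp, pow_add, hmn]
    ring

theorem partitionSeries_mul_prod {ι : Type*} [DecidableEq ι] (k : ι → ℕ) (hk : ∀ i, 2 ≤ k i)
    {a : ι} {B : Finset ι} (ha : a ∉ B) :
    partitionSeries (∏ i ∈ insert a B, momentFn (k i)) =
      ∑ A ∈ B.powerset, blockCumulant k (insert a A) *
        partitionSeries (∏ i ∈ B \ A, momentFn (k i)) := by
  have hK : ∀ A ∈ B.powerset, blockCumulant k (insert a A) *
        partitionSeries (∏ i ∈ B \ A, momentFn (k i)) =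
      PowerSeries.C (if A = ∅ then -(bernoulli (k a)) / (2 * (k a : ℚ)) else 0) *
        partitionSeries (∏ i ∈ B \ A, momentFn (k i)) +
      (PowerSeries.mk fun n => ∑ m ∈ n.divisors, (m : ℚ) ^ (k a - 1) *
          ∏ i ∈ A, (((n / m : ℕ) : ℚ) * (m : ℚ) ^ (k i - 1))) *
        partitionSeries (∏ i ∈ B \ A, momentFn (k i)) := by
    intro A hA
    rw [blockCumulant_insert k hk (fun h => ha (Finset.mem_powerset.1 hA h)), add_mul]
  rw [Finset.sum_congr rfl hK, Finset.sum_add_distrib,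
    Finset.sum_eq_single_of_mem ∅ (Finset.empty_mem_powerset _) (by
      intro A _ hA
      simp [hA])]
  ext N
  rw [Finset.prod_insert ha, if_pos rfl, map_add, map_sum, Finset.sdiff_empty,
    PowerSeries.coeff_C_mul, partitionSeries, partitionSeries, PowerSeries.coeff_mk,
    PowerSeries.coeff_mk]
  simp_rw [PowerSeries.coeff_mul, partitionSeries, PowerSeries.coeff_mk]
  rw [Finset.sum_comm]
  have h1 := sum_power_sum_mul (fun m => (m : ℚ) ^ (k a - 1)) (∏ i ∈ B, momentFn (k i)) N
  have h2 : ∑ l : Nat.Partition N, (momentFn (k a) * ∏ i ∈ B, momentFn (k i)) ⟨N, l⟩ =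
      -(bernoulli (k a)) / (2 * (k a : ℚ)) *
        ∑ l : Nat.Partition N, (∏ i ∈ B, momentFn (k i)) ⟨N, l⟩ +
      ∑ l : Nat.Partition N, (l.parts.map fun m : ℕ => (m : ℚ) ^ (k a - 1)).sum *
        (∏ i ∈ B, momentFn (k i)) ⟨N, l⟩ := by
    rw [Finset.mul_sum, ← Finset.sum_add_distrib]
    refine Finset.sum_congr rfl fun l _ => ?_
    rw [Pi.mul_apply, momentFn_apply, add_mul]
  rw [h2, h1]
  congr 1
  refine Finset.sum_congr rfl fun p _ => ?_
  simp_rw [Finset.sum_mul]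
  rw [Finset.sum_comm, ← Finset.sum_attach p.1.divisors]
  refine Finset.sum_congr rfl fun m _ => ?_
  -- Expanding ∏ (r·m^(k_i-1) + S_{k_i}) over B: the subset A collects the factors contributing the
  -- shift, B \ A those contributing S.
  simp_rw [Finset.prod_apply, momentFn_addParts, add_comm (momentFn _ _),
    Finset.prod_add]
  rw [Finset.sum_comm, Finset.mul_sum]
  refine Finset.sum_congr rfl fun A _ => ?_
  rw [← Finset.mul_sum, mul_assoc]

theorem qBracket_eq (f : IntPartition → ℚ) :
    qBracket f = partitionSeries f * (partitionSeries 1)⁻¹ := by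
  simp [qBracket, partitionSeries]

theorem qBracket_one : qBracket 1 = 1 := by
  rw [qBracket_eq]
  refine PowerSeries.mul_inv_cancel _ ?_
  rw [← PowerSeries.coeff_zero_eq_constantCoeff_apply]
  simp [partitionSeries]

theorem qBracket_mul_prod {ι : Type*} [DecidableEq ι] (k : ι → ℕ) (hk : ∀ i, 2 ≤ k i)
    {a : ι} {B : Finset ι} (ha : a ∉ B) :
    qBracket (∏ i ∈ insert a B, momentFn (k i)) =
      ∑ A ∈ B.powerset, blockCumulant k (insert a A) *
        qBracket (∏ i ∈ B \ A, momentFn (k i)) := by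
  simp_rw [qBracket_eq, partitionSeries_mul_prod k hk ha, Finset.sum_mul, mul_assoc]

end PartitionBracket

end

noncomputable section

/-! ### Sums over set partitions -/

namespace Finpartition

variable {ι R : Type*} [DecidableEq ι] [CommRing R]

/-- The sum over the partitions of `B` of the products of the values of `K` at the blocks. -/
def sumProd (K : Finset ι → R) (B : Finset ι) : R :=
  ∑ α : Finpartition B, ∏ A ∈ α.parts, K A

theorem sumProd_empty (K : Finset ι → R) : sumProd K ∅ = 1 := by
  rw [sumProd]
  refine (Fintype.sum_eq_single (default : Finpartition (⊥ : Finset ι))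
    fun α h => absurd (Subsingleton.elim (α := Finpartition (⊥ : Finset ι)) α default) h).trans ?_
  rw [show (default : Finpartition (⊥ : Finset ι)).parts = ∅ from
    Finpartition.parts_eq_empty_iff.2 rfl, Finset.prod_empty]

/-- A partition of a ∪ B amounts to the block a ∪ A containing a together with a partition of B \ A.
-/
theorem sumProd_insert (K : Finset ι → R) {a : ι} {B : Finset ι} (ha : a ∉ B) :
    sumProd K (insert a B) =
      ∑ A ∈ B.powerset, K (insert a A) * sumProd K (B \ A) := by
  simp_rw [sumProd, Finset.mul_sum]
  rw [Finset.sum_sigma']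
  symm
  have hnot : ∀ (A : Finset ι) (β : Finpartition (B \ A)) (t : Finset ι), a ∈ t →
      t ∉ β.parts := fun A β t hat ht =>
    ha (Finset.sdiff_subset (β.subset ht hat))
  refine Finset.sum_bij (fun x hx => x.2.extend (b := insert a x.1) (c := insert a B)
      (Finset.insert_ne_empty _ _) ?_ ?_) ?_ ?_ ?_ ?_
  · rw [Finset.disjoint_insert_right]
    exact ⟨fun h => ha (Finset.sdiff_subset h), Finset.sdiff_disjoint⟩
  · rw [Finset.mem_sigma, Finset.mem_powerset] at hx
    ext i
    have := @hx.1 i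
    simp only [Finset.sup_eq_union, Finset.mem_union, Finset.mem_sdiff, Finset.mem_insert]
    tauto
  · simp
  · rintro ⟨A, β⟩ hA ⟨A', β'⟩ hA' h
    rw [Finset.mem_sigma, Finset.mem_powerset] at hA hA'
    have hp : insert (insert a A) β.parts = insert (insert a A') β'.parts := congrArg parts h
    have h1 : insert a A = insert a A' := by
      have : insert a A ∈ insert (insert a A') β'.parts := hp ▸ Finset.mem_insert_self _ _
      rcases Finset.mem_insert.1 this with h | h
      · exact h
      · exact absurd h (hnot _ _ _ (Finset.mem_insert_self _ _))
    obtain rfl : A = A' := by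
      rw [← Finset.erase_insert (show a ∉ A from fun h => ha (hA.1 h)), h1,
        Finset.erase_insert (show a ∉ A' from fun h => ha (hA'.1 h))]
    congr 1
    ext1
    rw [← Finset.erase_insert (hnot A β _ (Finset.mem_insert_self a A)), hp,
      Finset.erase_insert (hnot A β' _ (Finset.mem_insert_self a A))]
  · intro α _
    have haB : a ∈ insert a B := Finset.mem_insert_self _ _
    have hmem : α.part a ∈ α.parts := α.part_mem.2 haB
    have ha' : a ∈ α.part a := α.mem_part_self.2 haB
    have hsup : (α.parts.erase (α.part a)).sup id = B \ (α.part a).erase a := by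
      ext i
      simp only [Finset.mem_sup, id, Finset.mem_erase, Finset.mem_sdiff]
      constructor
      · rintro ⟨t, ⟨ht, hαt⟩, hit⟩
        have hiP : i ∉ α.part a := fun h => ht (α.eq_of_mem_parts hαt hmem hit h)
        rcases Finset.mem_insert.1 (α.subset hαt hit) with rfl | h
        · exact absurd ha' hiP
        · exact ⟨h, fun h' => hiP h'.2⟩
      · rintro ⟨hiB, hi⟩
        have hia : i ≠ a := fun h => ha (h ▸ hiB)
        obtain ⟨t, ht, hit⟩ := α.exists_mem (Finset.mem_insert_of_mem hiB)
        exact ⟨t, ⟨fun h => hi ⟨hia, h ▸ hit⟩, ht⟩, hit⟩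
    refine ⟨⟨(α.part a).erase a, α.ofSubset (Finset.erase_subset _ _) hsup⟩, ?_, ?_⟩
    · simp only [Finset.mem_sigma, Finset.mem_powerset, Finset.mem_univ, and_true]
      intro i hi
      rw [Finset.mem_erase] at hi
      exact (Finset.mem_insert.1 (α.part_subset a hi.2)).resolve_left hi.1
    · ext1
      simp only [extend_parts, ofSubset_parts]
      rw [Finset.insert_erase ha', Finset.insert_erase hmem]
  · rintro ⟨A, β⟩ _
    rw [extend_parts, Finset.prod_insert (hnot A β _ (Finset.mem_insert_self a A))]

theorem eq_sumProd_of_recursion (K M : Finset ι → R) (h0 : M ∅ = 1)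
    (hM : ∀ (a : ι) (B : Finset ι), a ∉ B →
      M (insert a B) = ∑ A ∈ B.powerset, K (insert a A) * M (B \ A)) (B : Finset ι) :
    M B = sumProd K B := by
  induction B using Finset.strongInduction with
  | H B ih =>
    rcases B.eq_empty_or_nonempty with rfl | ⟨a, ha⟩
    · rw [h0, sumProd_empty]
    · rw [← Finset.insert_erase ha, hM _ _ (Finset.notMem_erase _ _),
        sumProd_insert K (Finset.notMem_erase _ _)]
      refine Finset.sum_congr rfl fun A _ => ?_
      rw [ih _ ((Finset.sdiff_subset).trans_ssubset (Finset.erase_ssubset ha))]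

open scoped Classical in
-- Partitioning every block of α separately is the same as choosing a refinement of α.
theorem prod_sumProd (K : Finset ι → R) {s : Finset ι} (α : Finpartition s) :
    ∏ A ∈ α.parts, sumProd K A =
      ∑ β : Finpartition s with β ≤ α, ∏ B ∈ β.parts, K B := by
  simp_rw [sumProd]
  rw [Finset.prod_sum]
  -- The separate partitions are recovered from the glued one: nonempty blocks lie in exactly one A.
  -- This yields injectivity.
  have hparts : ∀ (p : ∀ A ∈ α.parts, Finpartition A) (A) (hA : A ∈ α.parts),
      (p A hA).parts = (α.bind p).parts.filter (· ⊆ A) := by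
    intro p A hA
    ext t
    rw [Finset.mem_filter, mem_bind]
    constructor
    · exact fun h => ⟨⟨A, hA, h⟩, (p A hA).subset h⟩
    · rintro ⟨⟨A', hA', h⟩, htA⟩
      obtain ⟨i, hi⟩ := (p A' hA').nonempty_of_mem_parts h
      obtain rfl := α.eq_of_mem_parts hA hA' (htA hi) ((p A' hA').subset h hi)
      exact h
  refine Finset.sum_bij (fun p _ => α.bind p) ?_ ?_ ?_ ?_
  · intro p _
    rw [Finset.mem_filter]
    refine ⟨Finset.mem_univ _, fun t ht => ?_⟩
    obtain ⟨A, hA, h⟩ := mem_bind.1 ht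
    exact ⟨A, hA, (p A hA).le h⟩
  · intro p _ p' _ h
    funext A hA
    ext1
    rw [hparts, hparts, h]
  · intro β hβ
    rw [Finset.mem_filter] at hβ
    have hsup : ∀ A ∈ α.parts, (β.parts.filter (· ⊆ A)).sup id = A := by
      intro A hA
      ext i
      simp only [Finset.mem_sup, id, Finset.mem_filter]
      constructor
      · rintro ⟨t, ⟨_, h⟩, hi⟩
        exact h hi
      · intro hi
        obtain ⟨t, ht, hit⟩ := β.exists_mem (α.subset hA hi)
        obtain ⟨A', hA', htA'⟩ := hβ.2 ht
        obtain rfl := α.eq_of_mem_parts hA hA' hi (htA' hit)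
        exact ⟨t, ⟨ht, htA'⟩, hit⟩
    refine ⟨fun A hA => β.ofSubset (Finset.filter_subset _ _) (hsup A hA), by simp, ?_⟩
    ext t
    rw [mem_bind]
    simp only [ofSubset_parts, Finset.mem_filter]
    constructor
    · rintro ⟨_, _, h, _⟩
      exact h
    · intro ht
      obtain ⟨A, hA, h⟩ := hβ.2 ht
      exact ⟨A, hA, ht, h⟩
  · intro p _
    rw [bind_parts, Finset.prod_biUnion]
    rintro ⟨A, hA⟩ _ ⟨A', hA'⟩ _ hne
    rw [Function.onFun, Finset.disjoint_left]
    intro t ht ht'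
    refine hne (Subtype.ext ?_)
    obtain ⟨i, hi⟩ := (p A hA).nonempty_of_mem_parts ht
    exact α.eq_of_mem_parts hA hA' ((p A hA).subset ht hi) ((p A' hA').subset ht' hi)

end Finpartition

/-! ### Ordinary and connected brackets as sums over set partitions. -/

namespace PartitionBracket

theorem qBracket_prod {ι : Type*} [DecidableEq ι] (k : ι → ℕ) (hk : ∀ i, 2 ≤ k i)
    (B : Finset ι) :
    qBracket (∏ i ∈ B, momentFn (k i)) = Finpartition.sumProd (blockCumulant k) B :=
  Finpartition.eq_sumProd_of_recursion (blockCumulant k)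
    (fun B => qBracket (∏ i ∈ B, momentFn (k i))) (by simp [qBracket_one])
    (fun _ _ h => qBracket_mul_prod k hk h) B

theorem connectedBracket_momentFn {n : ℕ} (hn : 1 ≤ n) (k : Fin n → ℕ) (hk : ∀ i, 2 ≤ k i) :
    connectedBracket (fun i => momentFn (k i)) = blockCumulant k Finset.univ := by
  classical
  rw [connectedBracket]
  simp_rw [qBracket_prod k hk, Finpartition.prod_sumProd, Finset.smul_sum, Finset.sum_filter]
  rw [Finset.sum_comm]
  have h : ∀ β : SetPartition n,
      (∑ α : SetPartition n, if β ≤ α then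
        (IncidenceAlgebra.mu ℚ (α := SetPartition n) α ⊤) • ∏ B ∈ β.parts, blockCumulant k B
        else 0) = if β = ⊤ then ∏ B ∈ β.parts, blockCumulant k B else 0 := by
    intro β
    rw [← Finset.sum_filter, ← Finset.sum_smul]
    have hI : Finset.univ.filter (fun α : SetPartition n => β ≤ α) = Finset.Icc β ⊤ := by
      ext α
      simp
    -- The defining property of the Möbius function: the sum of μ(α, ⊤) over β ≤ α ≤ ⊤ is 1 if β = ⊤
    -- and 0 otherwise.
    rw [hI, IncidenceAlgebra.sum_Icc_mu_left]
    split_ifs <;> simp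
  refine (Finset.sum_congr rfl fun β _ => h β).trans ?_
  rw [Finset.sum_ite_eq' Finset.univ, if_pos (Finset.mem_univ _)]
  have hne : (Finset.univ : Finset (Fin n)) ≠ ⊥ :=
    (Finset.univ_nonempty_iff.2 ⟨⟨0, hn⟩⟩).ne_empty
  have htop : (⊤ : SetPartition n).parts = {Finset.univ} :=
    (Finset.Nonempty.subset_singleton_iff (Finpartition.parts_nonempty _ hne)).1
      (Finpartition.parts_top_subset _)
  rw [htop, Finset.prod_singleton]

end PartitionBracket

end

noncomputable section

namespace PartitionBracket

/-! ### Algebraic independence of the moment functions and the weight grading -/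

/-- The partition with `r j` parts equal to `j + 1`. -/
def ofMultiplicities {n : ℕ} (r : Fin n → ℕ) : IntPartition :=
  ⟨(∑ j, Multiset.replicate (r j) ((j : ℕ) + 1)).sum,
    ∑ j, Multiset.replicate (r j) ((j : ℕ) + 1), fun {i} hi => by
      obtain ⟨j, _, hj⟩ := Multiset.mem_sum.1 hi
      rw [Multiset.eq_of_mem_replicate hj]
      exact Nat.succ_pos _, rfl⟩

theorem momentFn_ofMultiplicities {n : ℕ} (k : ℕ) (r : Fin n → ℕ) :
    momentFn k (ofMultiplicities r) = -(bernoulli k) / (2 * (k : ℚ)) +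
      ∑ j, (r j : ℚ) * ((j : ℚ) + 1) ^ (k - 1) := by
  rw [momentFn_apply]
  congr 1
  have := map_sum ((Multiset.sumAddMonoidHom (M := ℚ)).comp
    (Multiset.mapAddMonoidHom fun m : ℕ => (m : ℚ) ^ (k - 1)))
    (fun j : Fin n => Multiset.replicate (r j) ((j : ℕ) + 1)) Finset.univ
  refine this.trans (Finset.sum_congr rfl fun j _ => ?_)
  simp

/-- After the affine substitution the polynomial vanishes on the grid ℕ^n, hence identically;
invertibility of A lets the substitution be undone. -/
theorem eq_zero_of_eval_affine_natCast {n : ℕ} (q : MvPolynomial (Fin n) ℚ) (c : Fin n → ℚ)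
    (A : Matrix (Fin n) (Fin n) ℚ) (hA : A.det ≠ 0)
    (h : ∀ r : Fin n → ℕ,
      MvPolynomial.eval (fun i => c i + ∑ j, (r j : ℚ) * A i j) q = 0) : q = 0 := by
  let Q : MvPolynomial (Fin n) ℚ := MvPolynomial.bind₁
    (fun i => MvPolynomial.C (c i) + ∑ j, MvPolynomial.X j * MvPolynomial.C (A i j)) q
  have hQ : ∀ y : Fin n → ℚ, MvPolynomial.eval y Q =
      MvPolynomial.eval (fun i => c i + ∑ j, y j * A i j) q := by
    intro y
    simp only [Q, MvPolynomial.eval, MvPolynomial.eval₂Hom_bind₁]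
    simp
  have hQ0 : Q = 0 := by
    refine MvPolynomial.funext_set (fun _ => Set.range (Nat.cast : ℕ → ℚ))
      (fun _ => Set.infinite_range_of_injective Nat.cast_injective) fun y hy => ?_
    choose r hr using fun i => hy i (Set.mem_univ i)
    obtain rfl : (fun i => (r i : ℚ)) = y := funext hr
    rw [hQ, h, map_zero]
  refine MvPolynomial.funext fun z => ?_
  have := hQ (A⁻¹.mulVec (z - c))
  have hz : (fun i => c i + ∑ j, (A⁻¹.mulVec (z - c)) j * A i j) = z := by
    funext i
    have h1 : A.mulVec (A⁻¹.mulVec (z - c)) = z - c := by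
      rw [Matrix.mulVec_mulVec, Matrix.mul_nonsing_inv _ (isUnit_iff_ne_zero.2 hA),
        Matrix.one_mulVec]
    have h2 := congrFun h1 i
    rw [Matrix.mulVec, dotProduct] at h2
    simp_rw [mul_comm _ (A i _)]
    rw [h2, Pi.sub_apply, add_sub_cancel]
  rw [hz, hQ0] at this
  rw [← this, map_zero, map_zero]

theorem algebraicIndependent_momentFn_fin (n : ℕ) :
    AlgebraicIndependent ℚ (fun i : Fin n => momentFn (2 * (i : ℕ) + 2)) := by
  rw [algebraicIndependent_iff]
  intro q hq
  let v : Fin n → ℚ := fun j => ((j : ℚ) + 1) ^ 2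
  let d : Fin n → ℚ := fun j => (j : ℚ) + 1
  -- The entry at (i, j) is (j+1)^(2i+1), the contribution of one part j+1 to S_{2i+2}. The nodes
  -- (j+1)^2 are distinct, so the determinant is nonzero.
  let A : Matrix (Fin n) (Fin n) ℚ := (Matrix.diagonal d * Matrix.vandermonde v).transpose
  refine eq_zero_of_eval_affine_natCast q
    (fun i => -(bernoulli (2 * (i : ℕ) + 2)) / (2 * ((2 * (i : ℕ) + 2 : ℕ) : ℚ))) A ?_ fun r => ?_
  · rw [Matrix.det_transpose, Matrix.det_mul, Matrix.det_diagonal]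
    refine mul_ne_zero (Finset.prod_ne_zero_iff.2 fun j _ => ?_)
      (Matrix.det_vandermonde_ne_zero_iff.2 fun i j hij => ?_)
    · simp only [d]; positivity
    · have : (i : ℚ) + 1 = (j : ℚ) + 1 :=
        (pow_left_inj₀ (by positivity) (by positivity) two_ne_zero).1 hij
      exact Fin.ext (by exact_mod_cast add_right_cancel this)
  · have h := congrFun hq (ofMultiplicities r)
    have h2 : MvPolynomial.aeval (fun i : Fin n => momentFn (2 * (i : ℕ) + 2)) q
        (ofMultiplicities r) = MvPolynomial.eval
          (fun i : Fin n => momentFn (2 * (i : ℕ) + 2) (ofMultiplicities r)) q := by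
      have := MvPolynomial.comp_aeval (R := ℚ) (fun i : Fin n => momentFn (2 * (i : ℕ) + 2))
        (Pi.evalAlgHom ℚ (fun _ : IntPartition => ℚ) (ofMultiplicities r))
      refine (DFunLike.congr_fun this q).trans ?_
      rw [← MvPolynomial.coe_aeval_eq_eval]
      rfl
    rw [h2] at h
    refine Eq.trans ?_ h
    congr 1
    congr 1
    funext i
    rw [momentFn_ofMultiplicities]
    congr 1
    refine Finset.sum_congr rfl fun j _ => ?_
    simp only [A, Matrix.transpose_apply, Matrix.diagonal_mul, Matrix.vandermonde_apply, v, d]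
    rw [← pow_mul, ← pow_succ']
    congr 2

theorem algebraicIndependent_momentFn :
    AlgebraicIndependent ℚ (fun i : ℕ => momentFn (2 * i + 2)) := by
  refine algebraicIndependent_of_finite_type fun t ht => ?_
  obtain ⟨N, hN⟩ := ht.bddAbove
  exact (algebraicIndependent_momentFn_fin (N + 1)).comp
    (fun i : t => (⟨i, Nat.lt_succ_of_le (hN i.2)⟩ : Fin (N + 1)))
    fun i j hij => Subtype.ext (congrArg Fin.val hij)

theorem momentAlgebra_eq :
    Algebra.adjoin ℚ (Set.range fun i : ℕ => momentFn (2 * i + 2)) = momentAlgebra := by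
  rw [momentAlgebra]
  congr 1
  ext f
  constructor
  · rintro ⟨i, rfl⟩
    exact ⟨2 * i + 2, by omega, ⟨i + 1, by ring⟩, rfl⟩
  · rintro ⟨k, h0, ⟨m, rfl⟩, rfl⟩
    exact ⟨m - 1, by dsimp only; congr 1; omega⟩

/-- The algebra `𝒮` is the polynomial algebra on the moment functions. -/
def momentEquiv : MvPolynomial ℕ ℚ ≃ₐ[ℚ] momentAlgebra :=
  algebraicIndependent_momentFn.aevalEquiv.trans (Subalgebra.equivOfEq _ _ momentAlgebra_eq)

theorem coe_momentEquiv (p : MvPolynomial ℕ ℚ) :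
    (momentEquiv p : IntPartition → ℚ) =
      MvPolynomial.aeval (fun i : ℕ => momentFn (2 * i + 2)) p := rfl

/-- The weight `2i + 2` of the `i`-th moment function `S_{2i+2}`. -/
def momentWeight (i : ℕ) : ℕ := 2 * i + 2

theorem exists_prod_momentFn_eq_aeval_monomial (d : ℕ →₀ ℕ) :
    ∃ (n : ℕ) (k : Fin n → ℕ), (∀ i, 0 < k i ∧ Even (k i)) ∧
      ∑ i, k i = Finsupp.weight momentWeight d ∧
      MvPolynomial.aeval (fun i : ℕ => momentFn (2 * i + 2)) (MvPolynomial.monomial d (1 : ℚ)) =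
        ∏ i, momentFn (k i) := by
  induction d using Finsupp.induction_linear with
  | zero => exact ⟨0, Fin.elim0, fun i => i.elim0, by simp, by simp⟩
  | add d d' h h' =>
    obtain ⟨n, k, h1, h2, h3⟩ := h
    obtain ⟨n', k', h1', h2', h3'⟩ := h'
    refine ⟨n + n', Fin.append k k', fun i => ?_, ?_, ?_⟩
    · refine Fin.addCases (fun i => ?_) (fun i => ?_) i
      · rw [Fin.append_left]; exact h1 i
      · rw [Fin.append_right]; exact h1' i
    · simp [Fin.sum_univ_add, h2, h2']
    · rw [← one_mul (1 : ℚ), ← MvPolynomial.monomial_mul, map_mul, h3, h3']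
      simp [Fin.prod_univ_add]
  | single i m =>
    refine ⟨m, fun _ => 2 * i + 2, fun _ => ⟨by positivity, ⟨i + 1, by ring⟩⟩, ?_, ?_⟩
    · simp [Finsupp.weight_single, momentWeight]
    · simp [MvPolynomial.aeval_monomial]

theorem momentEquiv_mem_momentGrading {w : ℕ} {p : MvPolynomial ℕ ℚ}
    (hp : p ∈ MvPolynomial.weightedHomogeneousSubmodule ℚ momentWeight w) :
    momentEquiv p ∈ momentGrading w := by
  rw [momentGrading, Submodule.mem_comap]
  change (momentEquiv p : IntPartition → ℚ) ∈ _
  rw [coe_momentEquiv, MvPolynomial.as_sum p, map_sum]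
  refine Submodule.sum_mem _ fun d hd => ?_
  obtain ⟨n, k, h1, h2, h3⟩ := exists_prod_momentFn_eq_aeval_monomial d
  rw [← mul_one (p.coeff d), ← smul_eq_mul, ← MvPolynomial.smul_monomial, map_smul]
  refine Submodule.smul_mem _ _ (Submodule.subset_span ⟨n, k, h1, ?_, h3⟩)
  rw [h2]
  exact hp (MvPolynomial.mem_support_iff.1 hd)

theorem exists_weightedHomogeneous_of_mem_span {w : ℕ} {f : IntPartition → ℚ}
    (hf : f ∈ Submodule.span ℚ {f : IntPartition → ℚ | ∃ (n : ℕ) (k : Fin n → ℕ),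
      (∀ i, 0 < k i ∧ Even (k i)) ∧ ∑ i, k i = w ∧ f = ∏ i, momentFn (k i)}) :
    ∃ p ∈ MvPolynomial.weightedHomogeneousSubmodule ℚ momentWeight w,
      MvPolynomial.aeval (fun i : ℕ => momentFn (2 * i + 2)) p = f := by
  have : Submodule.span ℚ {f : IntPartition → ℚ | ∃ (n : ℕ) (k : Fin n → ℕ),
      (∀ i, 0 < k i ∧ Even (k i)) ∧ ∑ i, k i = w ∧ f = ∏ i, momentFn (k i)} ≤
      (MvPolynomial.weightedHomogeneousSubmodule ℚ momentWeight w).map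
        (MvPolynomial.aeval (fun i : ℕ => momentFn (2 * i + 2))).toLinearMap := by
    rw [Submodule.span_le]
    rintro _ ⟨n, k, hk, rfl, rfl⟩
    have hk' : ∀ i, 2 * (k i / 2 - 1) + 2 = k i := fun i => by
      obtain ⟨h0, m, hm⟩ := hk i
      omega
    refine ⟨∏ i, MvPolynomial.X (k i / 2 - 1), ?_, ?_⟩
    · have := MvPolynomial.IsWeightedHomogeneous.prod Finset.univ
        (fun i => (MvPolynomial.X (k i / 2 - 1) : MvPolynomial ℕ ℚ)) k
        (w := momentWeight) fun i _ => by
          have := MvPolynomial.isWeightedHomogeneous_X ℚ momentWeight (k i / 2 - 1)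
          rwa [momentWeight, hk'] at this
      exact this
    · simp [hk']
  exact this hf

/-- Monomials of weighted degree w correspond to products of moment functions of total weight w, so
the grading can be transported from the polynomial ring. -/
theorem momentGrading_eq (w : ℕ) :
    momentGrading w =
      (MvPolynomial.weightedHomogeneousSubmodule ℚ momentWeight w).map
        (momentEquiv.toLinearEquiv : MvPolynomial ℕ ℚ →ₗ[ℚ] momentAlgebra) := by
  refine le_antisymm (fun f hf => ?_) ?_
  · obtain ⟨p, hp, h⟩ := exists_weightedHomogeneous_of_mem_span hf
    exact ⟨p, hp, Subtype.ext h⟩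
  · rintro _ ⟨p, hp, rfl⟩
    exact momentEquiv_mem_momentGrading hp

theorem momentGrading_gradedMonoid : SetLike.GradedMonoid momentGrading where
  one_mem := by
    rw [momentGrading_eq]
    exact ⟨1, MvPolynomial.isWeightedHomogeneous_one ℚ momentWeight, map_one momentEquiv⟩
  mul_mem := by
    intro i j f g hf hg
    rw [momentGrading_eq] at hf hg ⊢
    obtain ⟨p, hp, rfl⟩ := hf
    obtain ⟨p', hp', rfl⟩ := hg
    exact ⟨p * p', MvPolynomial.IsWeightedHomogeneous.mul hp hp', map_mul momentEquiv p p'⟩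

theorem momentGrading_isInternal : DirectSum.IsInternal momentGrading := by
  let _ := MvPolynomial.weightedGradedAlgebra ℚ momentWeight
  have h := DirectSum.Decomposition.isInternal
    (MvPolynomial.weightedHomogeneousSubmodule ℚ momentWeight)
  have hG : momentGrading = fun w => Submodule.orderIsoMapComap momentEquiv.toLinearEquiv
      (MvPolynomial.weightedHomogeneousSubmodule ℚ momentWeight w) :=
    funext momentGrading_eq
  rw [DirectSum.isInternal_submodule_iff_iSupIndep_and_iSup_eq_top] at h ⊢
  rw [hG]
  refine ⟨h.1.map_orderIso _, ?_⟩
  rw [← OrderIso.map_iSup, h.2, OrderIso.map_top]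

end PartitionBracket

end

noncomputable section

namespace PartitionBracket

open UpperHalfPlane hiding I
open Complex Filter Asymptotics
open Derivative (normalizedDerivOfComplex)

/-! ### Functions of moderate growth on the upper half plane -/

theorem eventually_comap_im_nhds_zero {p : ℍ → Prop} :
    (∀ᶠ τ in comap UpperHalfPlane.im (𝓝 (0 : ℝ)), p τ) ↔
      ∃ δ > 0, ∀ τ : ℍ, τ.im < δ → p τ := by
  rw [((Metric.nhds_basis_ball (x := (0 : ℝ))).comap UpperHalfPlane.im).eventually_iff]
  refine exists_congr fun δ => and_congr_right fun _ => forall_congr' fun τ => ?_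
  rw [Set.mem_preimage, Metric.mem_ball, Real.dist_eq, sub_zero, abs_of_pos τ.im_pos]

theorem eventually_atImInfty {p : ℍ → Prop} :
    (∀ᶠ τ in atImInfty, p τ) ↔ ∃ A, ∀ τ : ℍ, A ≤ τ.im → p τ :=
  atImInfty_mem _

/-- A power of 1 + 1/y is bounded for y ≥ 1 and is dominated by e^(C/y) near 0. -/
theorem isHolModerate_of_norm_le {φ : ℍ → ℂ} (hφ : MDifferentiable 𝓘(ℂ) 𝓘(ℂ) φ) {M : ℝ} {N : ℕ}
    (h : ∀ τ : ℍ, ‖φ τ‖ ≤ M * (1 + 1 / τ.im) ^ N) : IsHolModerate φ where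
  holomorphic := hφ
  growth_infinity C hC := by
    refine IsBigO.of_bound (|M| * 2 ^ N) (eventually_atImInfty.2 ⟨1, fun τ hτ => ?_⟩)
    have h1 : 1 / τ.im ≤ 1 := by rw [div_le_one τ.im_pos]; exact hτ
    have h0 : 0 < 1 / τ.im := one_div_pos.2 τ.im_pos
    have h2 : 1 ≤ Real.exp (C * τ.im) := Real.one_le_exp (by have := τ.im_pos; positivity)
    rw [Real.norm_eq_abs, Real.abs_exp]
    calc ‖φ τ‖ ≤ M * (1 + 1 / τ.im) ^ N := h τ
      _ ≤ |M| * 2 ^ N := by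
          gcongr
          · exact le_abs_self M
          · linarith
      _ ≤ |M| * 2 ^ N * Real.exp (C * τ.im) := le_mul_of_one_le_right (by positivity) h2
  growth_zero C hC := by
    refine IsBigO.of_bound (|M| * (max 1 (N / C)) ^ N) (Eventually.of_forall fun τ => ?_)
    have h0 : 0 < 1 / τ.im := one_div_pos.2 τ.im_pos
    rw [Real.norm_eq_abs, Real.abs_exp]
    -- The N-th power of the inequality 1 + x ≤ e^x at x = C/(N y), up to the factor max 1 (N/C).
    have key : (1 + 1 / τ.im) ^ N ≤ (max 1 (N / C)) ^ N * Real.exp (C / τ.im) := by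
      rcases Nat.eq_zero_or_pos N with rfl | hN
      · simpa using Real.one_le_exp (by have := τ.im_pos; positivity : 0 ≤ C / τ.im)
      have hN' : (0 : ℝ) < N := by exact_mod_cast hN
      have he : Real.exp (C / τ.im) = Real.exp (C / N * (1 / τ.im)) ^ N := by
        rw [← Real.exp_nat_mul]
        congr 1
        field_simp
      rw [he, ← mul_pow]
      refine pow_le_pow_left₀ (by positivity) ?_ N
      calc 1 + 1 / τ.im = 1 * 1 + N / C * (C / N * (1 / τ.im)) := by field_simp
        _ ≤ max 1 (N / C) * 1 + max 1 (N / C) * (C / N * (1 / τ.im)) := by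
            gcongr
            · exact le_max_left _ _
            · exact le_max_right _ _
        _ = max 1 (N / C) * (C / N * (1 / τ.im) + 1) := by ring
        _ ≤ max 1 (N / C) * Real.exp (C / N * (1 / τ.im)) := by
            gcongr
            exact Real.add_one_le_exp _
    calc ‖φ τ‖ ≤ M * (1 + 1 / τ.im) ^ N := h τ
      _ ≤ |M| * (1 + 1 / τ.im) ^ N := by
          gcongr
          exact le_abs_self M
      _ ≤ _ := by rw [mul_assoc]; gcongr

theorem isHolModerate_const (c : ℂ) : IsHolModerate (fun _ => c) :=
  isHolModerate_of_norm_le mdifferentiable_const (M := ‖c‖) (N := 0) fun τ => by simp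

theorem IsHolModerate.add {φ ψ : ℍ → ℂ} (hφ : IsHolModerate φ) (hψ : IsHolModerate ψ) :
    IsHolModerate (φ + ψ) where
  holomorphic := hφ.holomorphic.add hψ.holomorphic
  growth_infinity C hC := (hφ.growth_infinity C hC).add (hψ.growth_infinity C hC)
  growth_zero C hC := (hφ.growth_zero C hC).add (hψ.growth_zero C hC)

theorem IsHolModerate.mul {φ ψ : ℍ → ℂ} (hφ : IsHolModerate φ) (hψ : IsHolModerate ψ) :
    IsHolModerate (φ * ψ) where
  holomorphic := hφ.holomorphic.mul hψ.holomorphic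
  growth_infinity C hC := by
    refine ((hφ.growth_infinity (C / 2) (half_pos hC)).mul
      (hψ.growth_infinity (C / 2) (half_pos hC))).congr_right fun τ => ?_
    rw [← Real.exp_add]
    ring_nf
  growth_zero C hC := by
    refine ((hφ.growth_zero (C / 2) (half_pos hC)).mul
      (hψ.growth_zero (C / 2) (half_pos hC))).congr_right fun τ => ?_
    rw [← Real.exp_add]
    ring_nf

/-- Cauchy's estimate on the disc of radius y/2 about τ, where imaginary parts stay between y/2 and
3y/2. -/
theorem norm_normalizedDeriv_le {φ : ℍ → ℂ} (hφ : MDifferentiable 𝓘(ℂ) 𝓘(ℂ) φ) (τ : ℍ) {B : ℝ}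
    (hB : ∀ z : ℍ, τ.im / 2 ≤ z.im → z.im ≤ 3 * τ.im / 2 → ‖φ z‖ ≤ B) :
    ‖normalizedDerivOfComplex φ τ‖ ≤ B * (2 / τ.im) := by
  have hτ := τ.im_pos
  have him : ∀ z ∈ Metric.closedBall (τ : ℂ) (τ.im / 2), |z.im - τ.im| ≤ τ.im / 2 := by
    intro z hz
    have h1 := Complex.abs_im_le_norm (z - τ)
    rw [Complex.sub_im, coe_im] at h1
    rw [Metric.mem_closedBall, dist_eq_norm] at hz
    exact h1.trans hz
  have hpos : Metric.closedBall (τ : ℂ) (τ.im / 2) ⊆ {z : ℂ | 0 < z.im} := by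
    intro z hz
    have := (abs_le.1 (him z hz)).1
    change 0 < z.im
    linarith
  have hd : DiffContOnCl ℂ (φ ∘ ofComplex) (Metric.ball (τ : ℂ) (τ.im / 2)) :=
    ((UpperHalfPlane.mdifferentiable_iff.1 hφ).mono hpos).diffContOnCl_ball subset_rfl
  have h := Complex.norm_deriv_le_of_forall_mem_sphere_norm_le (half_pos hτ) hd (C := B) (by
    intro z hz
    have hz' := Metric.sphere_subset_closedBall hz
    have h1 := abs_le.1 (him z hz')
    rw [Function.comp_apply, ofComplex_apply_of_im_pos (hpos hz')]
    refine hB _ ?_ ?_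
    · change τ.im / 2 ≤ z.im
      linarith
    · change z.im ≤ 3 * τ.im / 2
      linarith)
  rw [normalizedDerivOfComplex, norm_mul]
  have h2 : ‖(2 * (Real.pi : ℂ) * I)⁻¹‖ ≤ 1 := by
    rw [norm_inv, norm_mul, norm_mul, Complex.norm_I, Complex.norm_real, Complex.norm_ofNat,
      Real.norm_eq_abs, abs_of_pos Real.pi_pos]
    refine inv_le_one_of_one_le₀ ?_
    have := Real.two_le_pi
    linarith
  calc _ ≤ 1 * (B / (τ.im / 2)) := by gcongr
    _ = _ := by field_simp

theorem IsHolModerate.normalizedDeriv {φ : ℍ → ℂ} (hφ : IsHolModerate φ) :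
    IsHolModerate (normalizedDerivOfComplex φ) where
  holomorphic := Derivative.normalizedDerivOfComplex_mdifferentiable hφ.holomorphic
  growth_infinity C hC := by
    -- On the Cauchy disc Im z ≤ 3y/2, so the exponent 2C/3 becomes at most C.
    obtain ⟨M, hM⟩ := (hφ.growth_infinity (2 * C / 3) (by positivity)).bound
    obtain ⟨A, hA⟩ := eventually_atImInfty.1 hM
    refine IsBigO.of_bound (2 * |M|) (eventually_atImInfty.2 ⟨max 1 (2 * A), fun τ hτ => ?_⟩)
    have h1 : 1 ≤ τ.im := (le_max_left _ _).trans hτ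
    have h2 : 2 * A ≤ τ.im := (le_max_right _ _).trans hτ
    rw [Real.norm_eq_abs, Real.abs_exp]
    have := norm_normalizedDeriv_le hφ.holomorphic τ (B := |M| * Real.exp (C * τ.im)) (by
      intro z hz1 hz2
      have hz := hA z (by linarith)
      rw [Real.norm_eq_abs, Real.abs_exp] at hz
      refine hz.trans ?_
      exact mul_le_mul (le_abs_self M) (Real.exp_le_exp.2 (by nlinarith)) (Real.exp_pos _).le
        (abs_nonneg M))
    refine this.trans ?_
    have h3 : 2 / τ.im ≤ 2 := by rw [div_le_iff₀ τ.im_pos]; linarith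
    calc |M| * Real.exp (C * τ.im) * (2 / τ.im) ≤ |M| * Real.exp (C * τ.im) * 2 := by gcongr
      _ = _ := by ring
  growth_zero C hC := by
    -- On the disc Im z ≥ y/2 doubles C/4 to C/2; the remaining e^(C/(2y)) absorbs the factor 2/y of
    -- Cauchy's estimate.
    obtain ⟨M, hM⟩ := (hφ.growth_zero (C / 4) (by positivity)).bound
    obtain ⟨δ, hδ, hA⟩ := eventually_comap_im_nhds_zero.1 hM
    refine IsBigO.of_bound (|M| * (4 / C))
      (eventually_comap_im_nhds_zero.2 ⟨δ / 2, half_pos hδ, fun τ hτ => ?_⟩)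
    have hpos := τ.im_pos
    rw [Real.norm_eq_abs, Real.abs_exp]
    have := norm_normalizedDeriv_le hφ.holomorphic τ
      (B := |M| * Real.exp (C / 2 * (1 / τ.im))) (by
      intro z hz1 hz2
      have hz := hA z (by linarith)
      rw [Real.norm_eq_abs, Real.abs_exp] at hz
      refine hz.trans ?_
      gcongr
      · exact le_abs_self M
      · rw [div_le_iff₀ z.im_pos]
        have h1 : 1 / 2 ≤ 1 / τ.im * z.im := by
          rw [div_mul_eq_mul_div, one_mul, le_div_iff₀ hpos]
          linarith
        nlinarith)
    refine this.trans ?_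
    have h3 : 2 / τ.im ≤ 4 / C * Real.exp (C / 2 * (1 / τ.im)) := by
      calc 2 / τ.im = 4 / C * (C / 2 * (1 / τ.im)) := by field_simp; norm_num
        _ ≤ 4 / C * Real.exp (C / 2 * (1 / τ.im)) := by
          gcongr
          exact (le_add_of_nonneg_right zero_le_one).trans (Real.add_one_le_exp _)
    calc |M| * Real.exp (C / 2 * (1 / τ.im)) * (2 / τ.im)
        ≤ |M| * Real.exp (C / 2 * (1 / τ.im)) * (4 / C * Real.exp (C / 2 * (1 / τ.im))) := by
          gcongr
      _ = |M| * (4 / C) * (Real.exp (C / 2 * (1 / τ.im)) * Real.exp (C / 2 * (1 / τ.im))) := by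
          ring
      _ = _ := by
          rw [← Real.exp_add]
          congr 2
          ring

/-- The binomial series sums to (1 - t)^(-d-1) with t = |q| = e^(-2πy), and 1/(1 - t) ≤ 1 + 1/y
because e^(2πy) ≥ 1 + y. -/
theorem norm_le_of_hasSum {φ : ℍ → ℂ} {a : ℕ → ℂ} {M : ℝ} (d : ℕ)
    (ha : ∀ n, ‖a n‖ ≤ M * ((n + d).choose d : ℝ))
    (h : ∀ τ : ℍ, HasSum (fun n => a n * cexp (2 * (Real.pi : ℂ) * I * (τ : ℂ)) ^ n) (φ τ))
    (τ : ℍ) : ‖φ τ‖ ≤ M * (1 + 1 / τ.im) ^ (d + 1) := by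
  have hτ := τ.im_pos
  set t : ℝ := ‖cexp (2 * (Real.pi : ℂ) * I * (τ : ℂ))‖ with ht
  have ht1 : t < 1 := norm_exp_two_pi_I_lt_one τ
  have ht0 : 0 ≤ t := norm_nonneg _
  have hM : 0 ≤ M := by simpa using (norm_nonneg _).trans (ha 0)
  have hs := (hasSum_choose_mul_geometric_of_norm_lt_one d (r := t)
    (by rwa [Real.norm_of_nonneg ht0])).mul_left M
  have h1 : ‖φ τ‖ ≤ M * (1 / (1 - t) ^ (d + 1)) := by
    rw [← (h τ).tsum_eq]
    refine tsum_of_norm_bounded hs fun n => ?_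
    rw [norm_mul, norm_pow, ← ht, ← mul_assoc]
    gcongr
    exact ha n
  have hexp : t = Real.exp (-(2 * Real.pi * τ.im)) := by
    rw [ht, Complex.norm_exp]
    congr 1
    simp
  have h2 : 1 / (1 - t) ≤ 1 + 1 / τ.im := by
    have h3 : t * (1 + τ.im) ≤ 1 := by
      have h4 : 1 + τ.im ≤ Real.exp (2 * Real.pi * τ.im) := by
        have := Real.add_one_le_exp (2 * Real.pi * τ.im)
        have := Real.two_le_pi
        nlinarith
      calc t * (1 + τ.im) ≤ t * Real.exp (2 * Real.pi * τ.im) := by gcongr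
        _ = 1 := by rw [hexp, ← Real.exp_add]; simp
    rw [div_le_iff₀ (by linarith)]
    field_simp
    nlinarith
  refine h1.trans ?_
  rw [← one_div_pow]
  have : 0 ≤ 1 / (1 - t) := one_div_nonneg.2 (by linarith)
  gcongr

/-- The ring of holomorphic functions of moderate growth. -/
def holModerate : Subalgebra ℂ (ℍ → ℂ) where
  carrier := {φ | IsHolModerate φ}
  mul_mem' := IsHolModerate.mul
  add_mem' := IsHolModerate.add
  algebraMap_mem' := isHolModerate_const

end PartitionBracket

end

noncomputable section

namespace PartitionBracket

open UpperHalfPlane hiding I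
open Complex Filter Asymptotics
open Derivative (normalizedDerivOfComplex)
open scoped ModularForm

/-! ### Quasimodular transformation behaviour -/

/-- The function `c / (cτ + d)` attached to a matrix in `SL₂(ℤ)`. -/
def cocycleFn (γ : SL(2, ℤ)) (τ : ℍ) : ℂ :=
  (γ 1 0 : ℂ) / ((γ 1 0 : ℂ) * (τ : ℂ) + (γ 1 1 : ℂ))

theorem cocycleFn_eq (γ : SL(2, ℤ)) :
    cocycleFn γ = fun τ : ℍ => (γ 1 0 : ℂ) * denom γ τ ^ (-1 : ℤ) := by
  funext τ
  rw [cocycleFn, ModularGroup.denom_apply, zpow_neg_one, div_eq_mul_inv]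

theorem mdifferentiable_cocycleFn (γ : SL(2, ℤ)) : MDifferentiable 𝓘(ℂ) 𝓘(ℂ) (cocycleFn γ) := by
  rw [cocycleFn_eq]
  exact mdifferentiable_const.mul (mdifferentiable_denom_zpow _ _)

theorem normalizedDeriv_cocycleFn (γ : SL(2, ℤ)) :
    normalizedDerivOfComplex (cocycleFn γ) =
      (fun _ => -(2 * (Real.pi : ℂ) * I)⁻¹) * cocycleFn γ ^ 2 := by
  funext τ
  have h := (hasDerivAt_denom_zpow γ (-1) τ).const_mul (γ 1 0 : ℂ)
  have h2 : (cocycleFn γ ∘ ofComplex) =ᶠ[𝓝 (τ : ℂ)]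
      fun w => (γ 1 0 : ℂ) * denom γ w ^ (-1 : ℤ) := by
    filter_upwards [isOpen_upperHalfPlaneSet.mem_nhds τ.im_pos] with w hw
    rw [cocycleFn_eq, Function.comp_apply, ofComplex_apply_of_im_pos hw]
  rw [normalizedDerivOfComplex, (h.congr_of_eventuallyEq h2).deriv, Pi.mul_apply, Pi.pow_apply,
    cocycleFn_eq]
  have h3 : denom γ τ ≠ 0 := denom_ne_zero _ τ
  simp only [show (-1 - 1 : ℤ) = -2 by norm_num, zpow_neg, zpow_ofNat]
  simp
  field_simp

theorem mdifferentiable_eval₂_cocycleFn (Ψ : Polynomial holModerate) (γ : SL(2, ℤ)) :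
    MDifferentiable 𝓘(ℂ) 𝓘(ℂ) (Ψ.eval₂ (holModerate.val : holModerate →+* (ℍ → ℂ))
      (cocycleFn γ)) := by
  induction Ψ using Polynomial.induction_on' with
  | add p q hp hq => rw [Polynomial.eval₂_add]; exact hp.add hq
  | monomial n f =>
    rw [Polynomial.eval₂_monomial]
    exact f.2.holomorphic.mul ((mdifferentiable_cocycleFn γ).pow n)

/-- With X = c/(cτ+d) one has DX = -X²/(2πi), so D maps polynomials in X to polynomials in X, by a
rule independent of γ. -/
theorem exists_normalizedDeriv_eval₂ (Ψ : Polynomial holModerate) :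
    ∃ Ψ' : Polynomial holModerate, ∀ γ : SL(2, ℤ),
      normalizedDerivOfComplex
        (Ψ.eval₂ (holModerate.val : holModerate →+* (ℍ → ℂ)) (cocycleFn γ)) =
        Ψ'.eval₂ (holModerate.val : holModerate →+* (ℍ → ℂ)) (cocycleFn γ) := by
  induction Ψ using Polynomial.induction_on' with
  | add p q hp hq =>
    obtain ⟨p', hp⟩ := hp
    obtain ⟨q', hq⟩ := hq
    refine ⟨p' + q', fun γ => ?_⟩
    rw [Polynomial.eval₂_add, Polynomial.eval₂_add, Derivative.normalizedDerivOfComplex_add _ _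
      (mdifferentiable_eval₂_cocycleFn p γ) (mdifferentiable_eval₂_cocycleFn q γ), hp, hq]
  | monomial n f =>
    refine ⟨Polynomial.monomial n ⟨_, f.2.normalizedDeriv⟩ + Polynomial.monomial (n + 1)
      (f * algebraMap ℂ holModerate (-(2 * (Real.pi : ℂ) * I)⁻¹ * n)), fun γ => ?_⟩
    have hX := mdifferentiable_cocycleFn γ
    simp only [Polynomial.eval₂_add, Polynomial.eval₂_monomial]
    change normalizedDerivOfComplex ((f : ℍ → ℂ) * cocycleFn γ ^ n) =
      normalizedDerivOfComplex (f : ℍ → ℂ) * cocycleFn γ ^ n +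
        ((f : ℍ → ℂ) * fun _ => -(2 * (Real.pi : ℂ) * I)⁻¹ * n) * cocycleFn γ ^ (n + 1)
    rw [Derivative.normalizedDerivOfComplex_mul _ _ f.2.holomorphic (hX.pow n),
      Derivative.normalizedDerivOfComplex_pow _ _ hX, normalizedDeriv_cocycleFn]
    congr 1
    funext τ
    cases n with
    | zero => simp
    | succ n =>
      simp only [Pi.mul_apply, Pi.pow_apply, Nat.add_sub_cancel, Pi.natCast_apply]
      ring

/-- Quasimodularity of weight `k`, the coefficient functions being collected in a polynomial. -/
def HasQuasimodularTransform (k : ℤ) (φ : ℍ → ℂ) : Prop :=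
  IsHolModerate φ ∧ ∃ Ψ : Polynomial holModerate, ∀ γ : SL(2, ℤ),
    φ ∣[k] γ = Ψ.eval₂ (holModerate.val : holModerate →+* (ℍ → ℂ)) (cocycleFn γ)

namespace HasQuasimodularTransform

variable {k l : ℤ} {φ ψ : ℍ → ℂ}

theorem zero : HasQuasimodularTransform k 0 :=
  ⟨isHolModerate_const 0, 0, fun γ => by rw [SlashAction.zero_slash, Polynomial.eval₂_zero]⟩

theorem one : HasQuasimodularTransform 0 1 := by
  refine ⟨isHolModerate_const 1, 1, fun γ => ?_⟩
  rw [Polynomial.eval₂_one]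
  funext τ
  simp [ModularForm.SL_slash_apply]

theorem add (hφ : HasQuasimodularTransform k φ) (hψ : HasQuasimodularTransform k ψ) :
    HasQuasimodularTransform k (φ + ψ) := by
  obtain ⟨h, Ψ, hΨ⟩ := hφ
  obtain ⟨h', Ψ', hΨ'⟩ := hψ
  refine ⟨h.add h', Ψ + Ψ', fun γ => ?_⟩
  rw [SlashAction.add_slash, Polynomial.eval₂_add, hΨ, hΨ']

theorem mul (hφ : HasQuasimodularTransform k φ) (hψ : HasQuasimodularTransform l ψ) :
    HasQuasimodularTransform (k + l) (φ * ψ) := by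
  obtain ⟨h, Ψ, hΨ⟩ := hφ
  obtain ⟨h', Ψ', hΨ'⟩ := hψ
  refine ⟨h.mul h', Ψ * Ψ', fun γ => ?_⟩
  rw [ModularForm.mul_slash_SL2, Polynomial.eval₂_mul, hΨ, hΨ']

theorem const_mul (c : ℂ) (hφ : HasQuasimodularTransform k φ) :
    HasQuasimodularTransform k ((fun _ => c) * φ) := by
  obtain ⟨h, Ψ, hΨ⟩ := hφ
  refine ⟨(isHolModerate_const c).mul h, Polynomial.C (algebraMap ℂ holModerate c) * Ψ,
    fun γ => ?_⟩
  rw [Polynomial.eval₂_mul, Polynomial.eval₂_C, ← hΨ]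
  funext τ
  change _ = c * _
  rw [ModularForm.SL_slash_apply, ModularForm.SL_slash_apply, Pi.mul_apply, mul_assoc]

/-- Rearranges D(φ|_k γ) = (Dφ)|_{k+2} γ - (k/(2πi)) X · φ|_k γ with X = c/(cτ+d). -/
theorem normalizedDeriv (hφ : HasQuasimodularTransform k φ) :
    HasQuasimodularTransform (k + 2) (normalizedDerivOfComplex φ) := by
  obtain ⟨h, Ψ, hΨ⟩ := hφ
  obtain ⟨Ψ', hΨ'⟩ := exists_normalizedDeriv_eval₂ Ψ
  refine ⟨h.normalizedDeriv, Ψ' + Polynomial.C (algebraMap ℂ holModerate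
    ((k : ℂ) * (2 * (Real.pi : ℂ) * I)⁻¹)) * Polynomial.X * Ψ, fun γ => ?_⟩
  have h1 := Derivative.normalizedDerivOfComplex_SL_slash (k := k) h.holomorphic (γ := γ)
  rw [hΨ, hΨ'] at h1
  rw [Polynomial.eval₂_add, Polynomial.eval₂_mul, Polynomial.eval₂_mul, Polynomial.eval₂_C,
    Polynomial.eval₂_X, h1]
  funext τ
  rw [Pi.add_apply, Pi.sub_apply, Pi.mul_apply, Pi.mul_apply, ModularGroup.denom_apply]
  exact (sub_add_cancel _ _).symm

theorem isQuasimodularForm (hφ : HasQuasimodularTransform k φ) :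
    ∃ p, IsQuasimodularForm k p φ := by
  obtain ⟨h, Ψ, hΨ⟩ := hφ
  refine ⟨Ψ.natDegree, h, fun r => (Ψ.coeff r : ℍ → ℂ), fun r => (Ψ.coeff r).2, fun γ τ => ?_⟩
  have h1 := congrFun (hΨ γ) τ
  rw [ModularForm.SL_slash_apply, ModularGroup.denom_apply, Polynomial.eval₂_eq_sum_range,
    Finset.sum_apply] at h1
  rw [mul_comm, h1, Fin.sum_univ_eq_sum_range (fun r => (Ψ.coeff r : ℍ → ℂ) τ *
    ((γ 1 0 : ℂ) / ((γ 1 0 : ℂ) * (τ : ℂ) + (γ 1 1 : ℂ))) ^ r)]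
  rfl

end HasQuasimodularTransform

/-! ### Power series that are `q`-expansions of quasimodular forms -/

/-- The power series `F` is the `q`-expansion of a function with the transformation behaviour of
a quasimodular form of weight `k`. -/
def IsQExpansion (k : ℤ) (F : PowerSeries ℚ) : Prop :=
  ∃ φ : ℍ → ℂ, HasQuasimodularTransform k φ ∧ ∀ τ : ℍ,
    HasSum (fun n : ℕ => ((PowerSeries.coeff n F : ℚ) : ℂ) *
      cexp (2 * (Real.pi : ℂ) * I * (τ : ℂ)) ^ n) (φ τ)

namespace IsQExpansion

variable {k l : ℤ} {F G : PowerSeries ℚ}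

theorem isQuasimodularSeries (h : IsQExpansion k F) : IsQuasimodularSeries k F := by
  obtain ⟨φ, hφ, hs⟩ := h
  obtain ⟨p, hp⟩ := hφ.isQuasimodularForm
  exact ⟨p, φ, hp, hs⟩

theorem zero : IsQExpansion k 0 :=
  ⟨0, .zero, fun τ => by simp⟩

theorem one : IsQExpansion 0 1 := by
  refine ⟨1, .one, fun τ => ?_⟩
  convert! hasSum_ite_eq (0 : ℕ) (1 : ℂ) using 2 with n
  rw [PowerSeries.coeff_one]
  split_ifs with h <;> simp [h]

theorem add (hF : IsQExpansion k F) (hG : IsQExpansion k G) : IsQExpansion k (F + G) := by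
  obtain ⟨φ, hφ, hs⟩ := hF
  obtain ⟨ψ, hψ, hs'⟩ := hG
  refine ⟨φ + ψ, hφ.add hψ, fun τ => ((hs τ).add (hs' τ)).congr_fun ?_⟩
  intro n
  simp [add_mul]

theorem smul (c : ℚ) (hF : IsQExpansion k F) : IsQExpansion k (c • F) := by
  obtain ⟨φ, hφ, hs⟩ := hF
  refine ⟨(fun _ => (c : ℂ)) * φ, hφ.const_mul c, fun τ => ((hs τ).mul_left (c : ℂ)).congr_fun ?_⟩
  intro n
  simp [mul_assoc]

theorem mul (hF : IsQExpansion k F) (hG : IsQExpansion l G) : IsQExpansion (k + l) (F * G) := by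
  obtain ⟨φ, hφ, hs⟩ := hF
  obtain ⟨ψ, hψ, hs'⟩ := hG
  refine ⟨φ * ψ, hφ.mul hψ, fun τ => ?_⟩
  have h1 := (hs τ).summable.norm
  have h2 := (hs' τ).summable.norm
  have h3 := (summable_norm_sum_mul_antidiagonal_of_summable_norm h1 h2).of_norm.hasSum
  rw [← tsum_mul_tsum_eq_tsum_sum_antidiagonal_of_summable_norm h1 h2, (hs τ).tsum_eq,
    (hs' τ).tsum_eq] at h3
  refine h3.congr_fun fun n => ?_
  rw [PowerSeries.coeff_mul, Rat.cast_sum, Finset.sum_mul]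
  refine Finset.sum_congr rfl fun p hp => ?_
  rw [← Finset.HasAntidiagonal.mem_antidiagonal.1 hp, pow_add, Rat.cast_mul]
  ring

theorem qDeriv (hF : IsQExpansion k F) : IsQExpansion (k + 2) (qDeriv F) := by
  obtain ⟨φ, hφ, hs⟩ := hF
  refine ⟨normalizedDerivOfComplex φ, hφ.normalizedDeriv, fun τ => ?_⟩
  let f : ℕ → ℂ → ℂ := fun n w => ((PowerSeries.coeff n F : ℚ) : ℂ) *
    cexp (2 * (Real.pi : ℂ) * I * w) ^ n
  -- The series at this point of height y/2 dominates the series throughout U, which justifies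
  -- termwise differentiation at τ.
  let τ' : ℍ := ⟨(τ.im / 2 : ℝ) * I, by simpa using τ.im_pos⟩
  let U : Set ℂ := {w | τ.im / 2 < w.im}
  have hτ := τ.im_pos
  have hU : IsOpen U := isOpen_lt continuous_const Complex.continuous_im
  have hτU : (τ : ℂ) ∈ U := by change τ.im / 2 < τ.im; linarith
  have hderiv : ∀ n w, HasDerivAt (f n) (2 * (Real.pi : ℂ) * I * (n * f n w)) w := by
    intro n w
    have h1 : HasDerivAt (fun w : ℂ => n * (2 * (Real.pi : ℂ) * I * w))
        (n * (2 * (Real.pi : ℂ) * I)) w := by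
      simpa using ((hasDerivAt_id w).const_mul (2 * (Real.pi : ℂ) * I)).const_mul (n : ℂ)
    have h2 := h1.cexp.const_mul ((PowerSeries.coeff n F : ℚ) : ℂ)
    simp only [f, ← Complex.exp_nat_mul]
    exact h2.congr_deriv (by ring)
  have hmain := Complex.hasSum_deriv_of_summable_norm (F := f) (U := U) (z := (τ : ℂ))
    (hs τ').summable.norm
    (fun n w _ => (hderiv n w).differentiableAt.differentiableWithinAt) hU (by
      intro n w hw
      simp only [f, norm_mul, norm_pow]
      have : ‖cexp (2 * (Real.pi : ℂ) * I * w)‖ ≤ ‖cexp (2 * (Real.pi : ℂ) * I * (τ' : ℂ))‖ := by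
        rw [Complex.norm_exp, Complex.norm_exp, Real.exp_le_exp]
        have hw' : τ.im / 2 < w.im := hw
        have hpi := Real.pi_pos
        have e1 : (2 * (Real.pi : ℂ) * I * w).re = -(2 * Real.pi * w.im) := by simp
        have e2 : (2 * (Real.pi : ℂ) * I * (τ' : ℂ)).re = -(2 * Real.pi * (τ.im / 2)) := by
          simp [τ']
        rw [e1, e2]
        nlinarith
      gcongr) hτU
  have hφ' : (φ ∘ ofComplex) =ᶠ[𝓝 (τ : ℂ)] fun w => ∑' n, f n w := by
    filter_upwards [isOpen_upperHalfPlaneSet.mem_nhds τ.im_pos] with w hw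
    rw [Function.comp_apply, ofComplex_apply_of_im_pos hw]
    exact (hs ⟨w, hw⟩).tsum_eq.symm
  rw [← hφ'.deriv_eq] at hmain
  refine (hmain.mul_left (2 * (Real.pi : ℂ) * I)⁻¹).congr_fun fun n => ?_
  have hne : 2 * (Real.pi : ℂ) * I ≠ 0 := Complex.two_pi_I_ne_zero
  rw [(hderiv n τ).deriv, inv_mul_cancel_left₀ hne]
  have := coeff_qDeriv_iterate 1 n F
  rw [Function.iterate_one, pow_one] at this
  rw [this, Rat.cast_mul, Rat.cast_natCast, mul_assoc]

theorem qDeriv_iterate (hF : IsQExpansion k F) (j : ℕ) :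
    IsQExpansion (k + 2 * j) (PartitionBracket.qDeriv^[j] F) := by
  induction j with
  | zero => simpa using hF
  | succ j ih =>
    rw [Function.iterate_succ_apply']
    convert ih.qDeriv using 1
    push_cast
    ring

theorem sum {ι : Type*} (s : Finset ι) (f : ι → PowerSeries ℚ)
    (h : ∀ i ∈ s, IsQExpansion k (f i)) : IsQExpansion k (∑ i ∈ s, f i) :=
  Finset.sum_induction f (IsQExpansion k) (fun _ _ => add) zero h

theorem prod {ι : Type*} (s : Finset ι) (w : ι → ℤ) (f : ι → PowerSeries ℚ)
    (h : ∀ i ∈ s, IsQExpansion (w i) (f i)) :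
    IsQExpansion (∑ i ∈ s, w i) (∏ i ∈ s, f i) := by
  classical
  induction s using Finset.induction_on with
  | empty => exact one
  | insert a s ha ih =>
    rw [Finset.sum_insert ha, Finset.prod_insert ha]
    exact (h a (Finset.mem_insert_self _ _)).mul
      (ih fun i hi => h i (Finset.mem_insert_of_mem hi))

end IsQExpansion

/-! ### The Eisenstein series are quasimodular -/

theorem coeff_eisensteinG {k n : ℕ} (hn : n ≠ 0) :
    PowerSeries.coeff n (eisensteinG k) = (ArithmeticFunction.sigma (k - 1) n : ℚ) := by
  rw [eisensteinG, PowerSeries.coeff_mk, if_neg hn, ArithmeticFunction.sigma_apply]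
  push_cast
  rfl

theorem hasSum_eisensteinG {k : ℕ} (hk : 1 ≤ k) (τ : ℍ) :
    HasSum (fun n : ℕ => ((PowerSeries.coeff n (eisensteinG k) : ℚ) : ℂ) *
      cexp (2 * (Real.pi : ℂ) * I * (τ : ℂ)) ^ n)
      (-(bernoulli k : ℂ) / (2 * k) + ∑' n : ℕ+, (ArithmeticFunction.sigma (k - 1) n : ℂ) *
        cexp (2 * (Real.pi : ℂ) * I * (τ : ℂ)) ^ (n : ℕ)) := by
  have hS : Summable fun n : ℕ => (ArithmeticFunction.sigma (k - 1) (n + 1) : ℂ) *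
      cexp (2 * (Real.pi : ℂ) * I * τ) ^ (n + 1) :=
    (summable_nat_add_iff 1).mpr (EisensteinSeries.summable_sigma_mul_cexp_pow hk τ)
  rw [tsum_pnat_eq_tsum_succ (f := fun n : ℕ => (ArithmeticFunction.sigma (k - 1) n : ℂ) *
    cexp (2 * (Real.pi : ℂ) * I * τ) ^ n), ← hasSum_nat_add_iff' 1]
  convert! hS.hasSum using 1
  · funext n
    rw [coeff_eisensteinG n.succ_ne_zero, Rat.cast_natCast]
  · simp [eisensteinG]

/-- For n ≥ 1, σ_{k-1}(n) ≤ n^k ≤ (n+1)⋯(n+k) = k!·C(n+k, k); the constant term is covered by the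
first summand. -/
theorem norm_coeff_eisensteinG_le {k : ℕ} (hk : 1 ≤ k) (n : ℕ) :
    ‖((PowerSeries.coeff n (eisensteinG k) : ℚ) : ℂ)‖ ≤
      (‖((PowerSeries.coeff 0 (eisensteinG k) : ℚ) : ℂ)‖ + k.factorial) *
        ((n + k).choose k : ℝ) := by
  have hc : (1 : ℝ) ≤ ((n + k).choose k : ℝ) := by
    exact_mod_cast Nat.choose_pos (Nat.le_add_left k n)
  rcases eq_or_ne n 0 with rfl | hn
  · refine (le_add_of_nonneg_right (Nat.cast_nonneg _)).trans (le_mul_of_one_le_right ?_ hc)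
    positivity
  · rw [coeff_eisensteinG hn, Rat.cast_natCast, Complex.norm_natCast, add_mul]
    refine le_add_of_nonneg_of_le (by positivity) ?_
    rw [← Nat.cast_mul, ← Nat.ascFactorial_eq_factorial_mul_choose]
    refine Nat.cast_le.2 ((ArithmeticFunction.sigma_le_pow_succ _ n).trans ?_)
    rw [Nat.sub_add_cancel hk]
    exact (Nat.pow_le_pow_left n.le_succ k).trans (Nat.pow_succ_le_ascFactorial _ k)

theorem isHolModerate_of_eisensteinG {k : ℕ} (hk : 1 ≤ k) {φ : ℍ → ℂ}
    (hφ : MDifferentiable 𝓘(ℂ) 𝓘(ℂ) φ)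
    (h : ∀ τ : ℍ, HasSum (fun n : ℕ => ((PowerSeries.coeff n (eisensteinG k) : ℚ) : ℂ) *
      cexp (2 * (Real.pi : ℂ) * I * (τ : ℂ)) ^ n) (φ τ)) : IsHolModerate φ :=
  isHolModerate_of_norm_le hφ (norm_le_of_hasSum k (norm_coeff_eisensteinG_le hk) h)

theorem isQExpansion_eisensteinG_two : IsQExpansion 2 (eisensteinG 2) := by
  let φ : ℍ → ℂ := (fun _ => (-1 / 24 : ℂ)) * EisensteinSeries.E2
  have hsum : ∀ τ : ℍ, HasSum (fun n : ℕ => ((PowerSeries.coeff n (eisensteinG 2) : ℚ) : ℂ) *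
      cexp (2 * (Real.pi : ℂ) * I * (τ : ℂ)) ^ n) (φ τ) := by
    intro τ
    have h := hasSum_eisensteinG one_le_two τ
    convert! h using 1
    simp only [φ, Pi.mul_apply, EisensteinSeries.E2_eq_tsum_cexp, bernoulli_two]
    push_cast
    ring
  have hmod : IsHolModerate φ := isHolModerate_of_eisensteinG one_le_two
    (mdifferentiable_const.mul E2_mdifferentiable) hsum
  -- E₂|γ = E₂ - (1/(2ζ(2))) · 2πi · c/(cτ+d), multiplied by -1/24 = -B₂/4: the transform has degree
  -- one in c/(cτ+d).
  refine ⟨φ, ⟨hmod, Polynomial.C ⟨φ, hmod⟩ + Polynomial.C (algebraMap ℂ holModerate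
    (1 / 24 * (1 / (2 * riemannZeta 2)) * (2 * (Real.pi : ℂ) * I))) * Polynomial.X,
    fun γ => ?_⟩, hsum⟩
  rw [Polynomial.eval₂_add, Polynomial.eval₂_mul, Polynomial.eval₂_C, Polynomial.eval₂_C,
    Polynomial.eval₂_X]
  funext τ
  have h := congrFun (EisensteinSeries.E2_slash_action γ) τ
  rw [ModularForm.SL_slash_apply] at h
  change _ = φ τ + 1 / 24 * (1 / (2 * riemannZeta 2)) * (2 * (Real.pi : ℂ) * I) * cocycleFn γ τ
  rw [ModularForm.SL_slash_apply]
  simp only [φ, Pi.mul_apply, mul_assoc (-1 / 24 : ℂ)]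
  rw [h, cocycleFn, ← ModularGroup.denom_apply]
  simp only [Pi.sub_apply, Pi.smul_apply, smul_eq_mul, EisensteinSeries.D2]
  ring

/-- By Euler's formula B_k = 0 would force ζ(k) = 0, but ζ has no zeros with real part above 1. This
permits rescaling the normalised E_k to G_k. -/
theorem bernoulli_ne_zero_of_even {k : ℕ} (hk : 2 ≤ k) (hk2 : Even k) : bernoulli k ≠ 0 := by
  obtain ⟨m, rfl⟩ := hk2
  intro h
  have hm : m ≠ 0 := by omega
  have h1 := riemannZeta_two_mul_nat hm
  rw [two_mul m, h, Rat.cast_zero, mul_zero, zero_div] at h1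
  refine riemannZeta_ne_zero_of_one_lt_re ?_ h1
  have : (1 : ℝ) < 2 * (m : ℝ) := by
    have : (1 : ℝ) ≤ m := by exact_mod_cast Nat.one_le_iff_ne_zero.2 hm
    linarith
  simpa using this

theorem isQExpansion_eisensteinG_of_three_le {k : ℕ} (hk : 3 ≤ k) (hk2 : Even k) :
    IsQExpansion k (eisensteinG k) := by
  have hB : (bernoulli k : ℂ) ≠ 0 := by
    exact_mod_cast bernoulli_ne_zero_of_even (by omega) hk2
  have hk0 : (k : ℂ) ≠ 0 := by exact_mod_cast (by omega : k ≠ 0)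
  let c : ℂ := -(bernoulli k : ℂ) / (2 * k)
  let φ : ℍ → ℂ := (fun _ => c) * ⇑(ModularForm.E hk)
  have hsum : ∀ τ : ℍ, HasSum (fun n : ℕ => ((PowerSeries.coeff n (eisensteinG k) : ℚ) : ℂ) *
      cexp (2 * (Real.pi : ℂ) * I * (τ : ℂ)) ^ n) (φ τ) := by
    intro τ
    have h := hasSum_eisensteinG (by omega : 1 ≤ k) τ
    convert! h using 1
    simp only [φ, c, Pi.mul_apply, EisensteinSeries.q_expansion_bernoulli hk hk2, zpow_natCast]
    field_simp
    ring
  have hmod : IsHolModerate φ := isHolModerate_of_eisensteinG (by omega)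
    (mdifferentiable_const.mul (ModularFormClass.holo (ModularForm.E hk))) hsum
  refine ⟨φ, ⟨hmod, Polynomial.C ⟨φ, hmod⟩, fun γ => ?_⟩, hsum⟩
  rw [Polynomial.eval₂_C]
  funext τ
  have h : (⇑(ModularForm.E hk) ∣[(k : ℤ)] γ) τ = ModularForm.E hk τ :=
    congrFun (SlashInvariantFormClass.slash_action_eq (ModularForm.E hk) _ ⟨γ, rfl⟩) τ
  change _ = φ τ
  rw [ModularForm.SL_slash_apply] at h ⊢
  simp only [φ, Pi.mul_apply, mul_assoc]
  rw [h]

theorem isQExpansion_eisensteinG {k : ℕ} (hk : 0 < k) (hk2 : Even k) :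
    IsQExpansion k (eisensteinG k) := by
  rcases Nat.lt_or_ge k 3 with h | h
  · obtain rfl : k = 2 := by
      obtain ⟨m, rfl⟩ := hk2
      omega
    exact isQExpansion_eisensteinG_two
  · exact isQExpansion_eisensteinG_of_three_le h hk2

/-! ### Quasimodularity of the `q`-brackets -/

theorem two_le_of_even {k : ℕ} (h : 0 < k ∧ Even k) : 2 ≤ k := by
  obtain ⟨h0, m, rfl⟩ := h
  omega

/-- Each of the |A| - 1 derivatives adds 2 to the weight, restoring |k_A| from |k_A| - 2|A| + 2,
which is itself even and at least 2. -/
theorem isQExpansion_blockCumulant {ι : Type*} (k : ι → ℕ) (hk : ∀ i, 0 < k i ∧ Even (k i))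
    {A : Finset ι} (hA : A.Nonempty) :
    IsQExpansion ((∑ i ∈ A, k i : ℕ) : ℤ) (blockCumulant k A) := by
  have h2 : 2 * A.card ≤ ∑ i ∈ A, k i := by
    rw [Finset.card_eq_sum_ones, Finset.mul_sum]
    exact Finset.sum_le_sum fun i _ => two_le_of_even (hk i)
  have he : Even (∑ i ∈ A, k i) := Finset.even_sum _ fun i _ => (hk i).2
  have hc := hA.card_pos
  have hG := (isQExpansion_eisensteinG (k := (∑ i ∈ A, k i) + 2 - 2 * A.card) (by omega) (by
    rw [Nat.even_sub (by omega)]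
    simp [he, Nat.even_add])).qDeriv_iterate (A.card - 1)
  rw [blockCumulant]
  convert hG using 1
  omega

theorem isQExpansion_qBracket_prod {n : ℕ} (k : Fin n → ℕ) (hk : ∀ i, 0 < k i ∧ Even (k i)) :
    IsQExpansion ((∑ i, k i : ℕ) : ℤ) (qBracket (∏ i, momentFn (k i))) := by
  rw [qBracket_prod k (fun i => two_le_of_even (hk i)), Finpartition.sumProd]
  refine IsQExpansion.sum _ _ fun α _ => ?_
  have h := IsQExpansion.prod α.parts (fun A => ((∑ i ∈ A, k i : ℕ) : ℤ)) (blockCumulant k)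
    fun A hA => isQExpansion_blockCumulant k hk (α.nonempty_of_mem_parts hA)
  have hs : ∑ A ∈ α.parts, ((∑ i ∈ A, k i : ℕ) : ℤ) = ((∑ i, k i : ℕ) : ℤ) := by
    rw [← Nat.cast_sum]
    congr 1
    have := Finset.sum_biUnion (f := k) (s := α.parts) (t := id) α.disjoint
    rw [α.biUnion_parts] at this
    exact this.symm
  rwa [hs] at h

theorem partitionSeries_add (f g : IntPartition → ℚ) :
    partitionSeries (f + g) = partitionSeries f + partitionSeries g := by
  ext n
  simp [partitionSeries, Finset.sum_add_distrib]

theorem partitionSeries_smul (c : ℚ) (f : IntPartition → ℚ) :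
    partitionSeries (c • f) = c • partitionSeries f := by
  ext n
  simp [partitionSeries, Finset.mul_sum]

theorem isQExpansion_qBracket_of_mem_span {w : ℕ} {f : IntPartition → ℚ}
    (hf : f ∈ Submodule.span ℚ {f : IntPartition → ℚ | ∃ (n : ℕ) (k : Fin n → ℕ),
      (∀ i, 0 < k i ∧ Even (k i)) ∧ ∑ i, k i = w ∧ f = ∏ i, momentFn (k i)}) :
    IsQExpansion w (qBracket f) := by
  induction hf using Submodule.span_induction with
  | mem f hf =>
    obtain ⟨n, k, hk, rfl, rfl⟩ := hf
    exact isQExpansion_qBracket_prod k hk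
  | zero =>
    have : qBracket 0 = 0 := by
      rw [qBracket_eq, ← zero_smul ℚ (0 : IntPartition → ℚ), partitionSeries_smul, zero_smul,
        zero_mul]
    rw [this]
    exact .zero
  | add f g _ _ hf hg =>
    rw [qBracket_eq, partitionSeries_add, add_mul, ← qBracket_eq, ← qBracket_eq]
    exact hf.add hg
  | smul c f _ hf =>
    rw [qBracket_eq, partitionSeries_smul, smul_mul_assoc, ← qBracket_eq]
    exact hf.smul c

end PartitionBracket

end

theorem mainTheorem3 :
    PartitionBracket.IsQuasimodularAlgebra
      PartitionBracket.momentAlgebra PartitionBracket.momentGrading ∧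
    (∀ (n : ℕ) (k : Fin n → ℕ), (∀ i, 0 < k i ∧ Even (k i)) →
      PartitionBracket.qBracket (∏ i, PartitionBracket.momentFn (k i)) =
        ∑ α : PartitionBracket.SetPartition n, ∏ A ∈ α.parts,
          PartitionBracket.qDeriv^[A.card - 1]
            (PartitionBracket.eisensteinG ((∑ i ∈ A, k i) + 2 - 2 * A.card))) ∧
    (∀ (n : ℕ) (k : Fin n → ℕ), 1 ≤ n → (∀ i, 0 < k i ∧ Even (k i)) →
      PartitionBracket.connectedBracket (fun i => PartitionBracket.momentFn (k i)) =
        PartitionBracket.qDeriv^[n - 1]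
          (PartitionBracket.eisensteinG ((∑ i, k i) + 2 - 2 * n))) := by
  refine ⟨⟨PartitionBracket.momentGrading_gradedMonoid, PartitionBracket.momentGrading_isInternal,
    fun w f hf => ?_⟩, fun n k hk => ?_, fun n k hn hk => ?_⟩
  · exact (PartitionBracket.isQExpansion_qBracket_of_mem_span hf).isQuasimodularSeries
  · exact PartitionBracket.qBracket_prod k
      (fun i => PartitionBracket.two_le_of_even (hk i)) Finset.univ
  · rw [PartitionBracket.connectedBracket_momentFn hn k
      (fun i => PartitionBracket.two_le_of_even (hk i)), PartitionBracket.blockCumulant,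
      Finset.card_univ, Fintype.card_fin]
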